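/- **Setting.** Fix a deadline $T>0$. The source harvests energy according to $E_s$, the relay according to $E_r$, and data arrive at the source according to $B_s$; these cumulative curves are nonnegative and nondecreasing on $[0,T]$ and, off a finite set of points (where they may jump), continuously differentiable with bounded derivative. The rate functions $r_{sr},r_{rd}:[0,\infty)\to[0,\infty)$ are continuous, strictly increasing, strictly concave, vanish at $0$ and tend to $\infty$. A power curve is a piecewise continuous function $p:[0,T]\to[0,\infty)$ (continuous off a finite set, with finite one-sided limits). **Point-to-point problem.** For a rate function $r$, energy curve $E$ and arrival data curve $B$, a power curve $p$ is feasible if $\int_0^t p\le E(t)$ and $\int_0^t r(p)\le B(t)$ for all $t\in[0,T]$. It is optimal if it is feasible, maximizes $\int_0^T r(p)$ among feasible power curves and, among the maximizers, minimizes the used energy $\int_0^T p$. **Two-hop (full-duplex) problem.** A pair $(p_{sr},p_{rd})$ is feasible if $p_{sr}$ is feasible for $(r_{sr},E_s,B_s)$ and $p_{rd}$ is feasible for $(r_{rd},E_r,B_{sr})$, where $B_{sr}(t)=\int_0^t r_{sr}(p_{sr})$. It is optimal if it is feasible, maximizes the delivered data $\int_0^T r_{rd}(p_{rd})$ among feasible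 pairs and, among the maximizers, minimizes both the source energy $\int_0^T p_{sr}$ and the relay energy $\int_0^T p_{rd}$. **Notation.** Let $p^*_{sr,s}$ be an optimal power curve of the point-to-point problem $(r_{sr},E_s,B_s)$ at the source, and $B^*_{sr,s}(t)=\int_0^t r_{sr}(p^*_{sr,s})$. For a source curve $B_{sr}$ let $p^*_{rd,B_{sr}}$ be an optimal power curve of the point-to-point problem $(r_{rd},E_r,B_{sr})$ at the relay, and $B^*_{rd,B_{sr}}(t)=\int_0^t r_{rd}(p^*_{rd,B_{sr}})$. **Theorem (relay optimal policy).** For every choice of the optimal power curves $p^*_{sr,s}$ and $p^*_{rd,B^*_{sr,s}}$: 1. There is a source power curve $p$ such that $(p,\,p^*_{rd,B^*_{sr,s}})$ is an optimal policy of the two-hop problem, and every optimal policy of the two-hop problem has the relay data curve $B_r^*(t)=B^*_{rd,B^*_{sr,s}}(t)$ for all $t\in[0,T]$. 2. For every feasible source curve $B_{sr}$ and every optimal power curve $p^*_{rd,B_{sr}}$, $B^*_{rd,B_{sr}}(t)\le B^*_{rd,B^*_{sr,s}}(t)$ for all $t\in[0,T]$. 3. If $(p_{sr},p_{rd})$ is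 feasible for the two-hop problem and $\int_0^T r_{rd}(p_{rd})=B^*_{rd,B^*_{sr,s}}(T)$, then $\int_0^T p^*_{rd,B^*_{sr,s}}\le\int_0^T p_{rd}$, and this inequality is strict if the data curve $\int_0^t r_{rd}(p_{rd})$ differs from $B^*_{rd,B^*_{sr,s}}(t)$ at some $t\in[0,T]$. -/

import Mathlib

open Set Filter Topology

/-- `f` is piecewise continuous on `[0, T]`: continuous off a finite set, with finite
one-sided limits at every point. -/
structure PiecewiseContinuous (T : ℝ) (f : ℝ → ℝ) : Prop where
  continuousOn : ∃ S : Set ℝ, S.Finite ∧ ContinuousOn f (Icc 0 T \ S)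
  right_limit : ∀ s ∈ Ico 0 T, ∃ l : ℝ, Tendsto f (𝓝[>] s) (𝓝 l)
  left_limit : ∀ s ∈ Ioc 0 T, ∃ l : ℝ, Tendsto f (𝓝[<] s) (𝓝 l)

/-- A cumulative arrival curve (harvested energy or arrived data) up to the deadline `T`:
`A t` is the amount that has arrived in `[0, t]`. It may jump at finitely many points and is
otherwise continuously differentiable with bounded derivative. -/
structure IsArrivalCurve (T : ℝ) (A : ℝ → ℝ) : Prop where
  nonneg : ∀ t ∈ Icc 0 T, 0 ≤ A t
  mono : MonotoneOn A (Icc 0 T)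
  piecewise_smooth : ∃ S : Set ℝ, S.Finite ∧
    (∀ t ∈ Ioo 0 T \ S, DifferentiableAt ℝ A t) ∧
    ContinuousOn (deriv A) (Ioo 0 T \ S) ∧
    ∃ M : ℝ, ∀ t ∈ Ioo 0 T \ S, |deriv A t| ≤ M

/-- A rate function: transmission rate as a function of the (nonnegative) power. Only its values
on `[0, ∞)` matter. -/
structure IsRateFunction (r : ℝ → ℝ) : Prop where
  continuousOn : ContinuousOn r (Ici 0)
  strictConcaveOn : StrictConcaveOn ℝ (Ici 0) r
  strictMonoOn : StrictMonoOn r (Ici 0)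
  tendsto_atTop : Tendsto r atTop atTop
  zero : r 0 = 0

/-- The transmitted energy curve of the power curve `p`. -/
noncomputable def energyCurve (p : ℝ → ℝ) (t : ℝ) : ℝ := ∫ τ in (0 : ℝ)..t, p τ

/-- The transmitted data curve of the power curve `p` on a link with rate function `r`. -/
noncomputable def dataCurve (r p : ℝ → ℝ) (t : ℝ) : ℝ := ∫ τ in (0 : ℝ)..t, r (p τ)

/-- `p` is a feasible power curve for the point-to-point problem on a link with rate function `r`,
harvested energy curve `E`, arrival data curve `B` and deadline `T`. -/
structure PtPFeasible (r E B : ℝ → ℝ) (T : ℝ) (p : ℝ → ℝ) : Prop where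
  piecewiseContinuous : PiecewiseContinuous T p
  nonneg : ∀ t ∈ Icc 0 T, 0 ≤ p t
  energy_causal : ∀ t ∈ Icc 0 T, energyCurve p t ≤ E t
  data_causal : ∀ t ∈ Icc 0 T, dataCurve r p t ≤ B t

/-- `p` is optimal for the point-to-point throughput maximization problem: it maximizes the data
transmitted by time `T` and, among the maximizers, it minimizes the energy used by time `T`. -/
structure PtPOptimal (r E B : ℝ → ℝ) (T : ℝ) (p : ℝ → ℝ) : Prop where
  feasible : PtPFeasible r E B T p
  throughput_max : ∀ q, PtPFeasible r E B T q → dataCurve r q T ≤ dataCurve r p T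
  energy_min : ∀ q, PtPFeasible r E B T q → dataCurve r q T = dataCurve r p T →
    energyCurve p T ≤ energyCurve q T

/-- The constraints of the two-hop problem: `p` is the power curve of the source and `q` that of
the relay, and each node obeys its energy and data causality conditions. The data that arrive at
the relay are the data that the source transmits. -/
structure TwoHopFeasible (rsr rrd Es Er Bs : ℝ → ℝ) (T : ℝ) (p q : ℝ → ℝ) : Prop where
  source : PtPFeasible rsr Es Bs T p
  relay : PtPFeasible rrd Er (dataCurve rsr p) T q

/-- `(p, q)` is an optimal policy of the two-hop problem: it maximizes the data delivered to the
receiver by time `T` and, among the maximizing policies, it minimizes the energy used at the source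
and the energy used at the relay. -/
structure TwoHopOptimal (rsr rrd Es Er Bs : ℝ → ℝ) (T : ℝ) (p q : ℝ → ℝ) : Prop where
  feasible : TwoHopFeasible rsr rrd Es Er Bs T p q
  throughput_max : ∀ p' q', TwoHopFeasible rsr rrd Es Er Bs T p' q' →
    dataCurve rrd q' T ≤ dataCurve rrd q T
  energy_min : ∀ p' q', TwoHopFeasible rsr rrd Es Er Bs T p' q' →
    dataCurve rrd q' T = dataCurve rrd q T →
    energyCurve p T ≤ energyCurve p' T ∧ energyCurve q T ≤ energyCurve q' T

/-!
In terms of rates instead of powers the feasible set of the point-to-point problem is convex, and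
strict concavity of the rate function makes averaging two rate curves save energy
(`IsRateFunction.exists_mix`). This gives a variational inequality for optimal curves
(`PtPOptimal.perturb`), and with it:

* An optimal data curve is affine wherever it lies above its chord or both constraints are slack
  (`PtPOptimal.isAffineOn`). Hence it is convex: power never decreases.
* A feasible curve that is ahead of the optimal one in data is also ahead in energy
  (`PtPOptimal.energy_le_of_data_le`), so both constraints are slack there and the optimal data
  curve is affine. Therefore an optimal data curve dominates every convex curve below a feasible
  data curve (`PtPOptimal.le_dataCurve_of_convexOn`).

The optimal relay curve `q` for an arbitrary source curve has a convex data curve. By the domination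
property at the source, `q` is feasible for the optimal source curve too, and by the same
property at the relay it is dominated by `prd`. This is the third claim.

An arbitrary two-hop policy need not have a convex relay curve, and there may be no optimal relay curve
for its source curve. It is compared with `prd` by a sufficient condition for optimality,
`energy_le_of_slackness`: a nondecreasing power curve that is constant wherever the competitor is
ahead in both energy and data is the better one. The condition holds for `prd`
(`relay_comparison`), so no policy delivers more data, nor as much data with less energy; averaging
makes the second statement strict (`relay_energy_lt`).

It remains to find a source curve of least energy that supports `prd`. It is the curve `psr` with its
power capped at the level at which it delivers just the data of `prd`: it is the cheapest
way to deliver this amount by the same sufficient condition, and it supports `prd` by convexity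
(`PtPOptimal.exists_capped`).
-/

/-! ### Piecewise continuous functions -/

namespace PiecewiseContinuous

variable {T : ℝ} {f g : ℝ → ℝ}

theorem congr (hf : PiecewiseContinuous T f) (h : EqOn g f (Icc 0 T)) :
    PiecewiseContinuous T g := by
  refine ⟨?_, fun s hs => ?_, fun s hs => ?_⟩
  · obtain ⟨S, hS, hc⟩ := hf.continuousOn
    exact ⟨S, hS, hc.congr fun x hx => h hx.1⟩
  · obtain ⟨l, hl⟩ := hf.right_limit s hs
    refine ⟨l, hl.congr' ?_⟩
    filter_upwards [Ioo_mem_nhdsGT hs.2] with x hx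
    exact (h ⟨hs.1.trans hx.1.le, hx.2.le⟩).symm
  · obtain ⟨l, hl⟩ := hf.left_limit s hs
    refine ⟨l, hl.congr' ?_⟩
    filter_upwards [Ioo_mem_nhdsLT hs.1] with x hx
    exact (h ⟨hx.1.le, hx.2.le.trans hs.2⟩).symm

theorem comp₂ {φ : ℝ × ℝ → ℝ} (hφ : Continuous φ) (hf : PiecewiseContinuous T f)
    (hg : PiecewiseContinuous T g) : PiecewiseContinuous T fun t => φ (f t, g t) := by
  refine ⟨?_, fun s hs => ?_, fun s hs => ?_⟩
  · obtain ⟨S, hS, hc⟩ := hf.continuousOn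
    obtain ⟨S', hS', hc'⟩ := hg.continuousOn
    refine ⟨S ∪ S', hS.union hS', hφ.comp_continuousOn ?_⟩
    exact (hc.mono fun x hx => ⟨hx.1, fun h => hx.2 (Or.inl h)⟩).prodMk
      (hc'.mono fun x hx => ⟨hx.1, fun h => hx.2 (Or.inr h)⟩)
  · obtain ⟨l, hl⟩ := hf.right_limit s hs
    obtain ⟨l', hl'⟩ := hg.right_limit s hs
    exact ⟨φ (l, l'), (hφ.tendsto (l, l')).comp (hl.prodMk_nhds hl')⟩
  · obtain ⟨l, hl⟩ := hf.left_limit s hs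
    obtain ⟨l', hl'⟩ := hg.left_limit s hs
    exact ⟨φ (l, l'), (hφ.tendsto (l, l')).comp (hl.prodMk_nhds hl')⟩

theorem comp {φ : ℝ → ℝ} (hφ : Continuous φ) (hf : PiecewiseContinuous T f) :
    PiecewiseContinuous T fun t => φ (f t) :=
  comp₂ (φ := fun x => φ x.1) (by fun_prop) hf hf

theorem const (c : ℝ) : PiecewiseContinuous T fun _ => c :=
  ⟨⟨∅, finite_empty, continuousOn_const⟩, fun _ _ => ⟨c, tendsto_const_nhds⟩,
    fun _ _ => ⟨c, tendsto_const_nhds⟩⟩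

/-- The points of `[0, T]` at which `f` is continuous include all but finitely many. -/
theorem exists_continuousAt (hf : PiecewiseContinuous T f) :
    ∃ S : Set ℝ, S.Finite ∧ ∀ t ∈ Icc 0 T \ S, t ∈ Ioo 0 T ∧ ContinuousAt f t := by
  obtain ⟨S, hS, hc⟩ := hf.continuousOn
  refine ⟨insert 0 (insert T S), (hS.insert T).insert 0, ?_⟩
  rintro t ⟨ht, htS⟩
  simp only [mem_insert_iff, not_or] at htS
  have h1 : t ∈ Ioo 0 T := ⟨lt_of_le_of_ne ht.1 (Ne.symm htS.1), lt_of_le_of_ne ht.2 htS.2.1⟩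
  exact ⟨h1, hc.continuousAt <| inter_mem (Icc_mem_nhds h1.1 h1.2)
    (hS.isClosed.isOpen_compl.mem_nhds htS.2.2)⟩

theorem exists_bound (hf : PiecewiseContinuous T f) : ∃ M, ∀ t ∈ Icc 0 T, |f t| ≤ M := by
  have key : ∀ l : ℝ, ∀ F : Filter ℝ, Tendsto f F (𝓝 l) → ∀ᶠ x in F, |f x| ≤ |l| + 1 :=
    fun l F h => (h.abs.eventually_lt_const (lt_add_one |l|)).mono fun x hx => hx.le
  refine isCompact_Icc.induction_on (p := fun s => ∃ M, ∀ t ∈ s, |f t| ≤ M) ⟨0, by simp⟩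
    (fun s t hst ⟨M, hM⟩ => ⟨M, fun x hx => hM x (hst hx)⟩) ?_ ?_
  · rintro s t ⟨M, hM⟩ ⟨N, hN⟩
    refine ⟨max M N, ?_⟩
    rintro x (hx | hx)
    · exact (hM x hx).trans (le_max_left _ _)
    · exact (hN x hx).trans (le_max_right _ _)
  · intro x hx
    have hL : ∃ M, ∀ᶠ y in 𝓝[<] x, y ∈ Icc 0 T → |f y| ≤ M := by
      rcases eq_or_lt_of_le hx.1 with h | h
      · refine ⟨0, ?_⟩
        filter_upwards [self_mem_nhdsWithin] with y hy hy'
        exact absurd hy'.1 (not_le.2 (h ▸ hy))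
      · obtain ⟨l, hl⟩ := hf.left_limit x ⟨h, hx.2⟩
        exact ⟨_, (key l _ hl).mono fun y hy _ => hy⟩
    have hR : ∃ M, ∀ᶠ y in 𝓝[>] x, y ∈ Icc 0 T → |f y| ≤ M := by
      rcases eq_or_lt_of_le hx.2 with h | h
      · refine ⟨0, ?_⟩
        filter_upwards [self_mem_nhdsWithin] with y hy hy'
        exact absurd hy'.2 (not_le.2 (h ▸ hy))
      · obtain ⟨l, hl⟩ := hf.right_limit x ⟨hx.1, h⟩
        exact ⟨_, (key l _ hl).mono fun y hy _ => hy⟩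
    obtain ⟨M, hM⟩ := hL
    obtain ⟨N, hN⟩ := hR
    have : ∀ᶠ y in 𝓝 x, y ∈ Icc 0 T → |f y| ≤ max (max M N) |f x| := by
      rw [← nhdsLT_sup_nhdsGE, ← nhdsGT_sup_nhdsWithin_singleton, eventually_sup, eventually_sup]
      refine ⟨hM.mono fun y hy h => (hy h).trans (by simp),
        hN.mono fun y hy h => (hy h).trans (by simp), ?_⟩
      filter_upwards [self_mem_nhdsWithin] with y hy _
      rw [mem_singleton_iff.1 hy]
      exact le_max_right _ _
    refine ⟨Icc 0 T ∩ {y | y ∈ Icc 0 T → |f y| ≤ max (max M N) |f x|},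
      inter_mem_nhdsWithin _ this, _, fun t ht => ht.2 ht.1⟩

theorem integrableOn (hf : PiecewiseContinuous T f) :
    MeasureTheory.IntegrableOn f (Icc 0 T) := by
  obtain ⟨M, hM⟩ := hf.exists_bound
  obtain ⟨S, hS, hc⟩ := hf.continuousOn
  have hae : (Icc 0 T \ S : Set ℝ) =ᵐ[MeasureTheory.volume] Icc 0 T :=
    MeasureTheory.sdiff_null_ae_eq_self (hS.measure_zero _)
  refine MeasureTheory.Integrable.of_bound (C := M) ?_ ?_
  · rw [← MeasureTheory.Measure.restrict_congr_set hae]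
    exact hc.aestronglyMeasurable (measurableSet_Icc.diff hS.measurableSet)
  · exact (MeasureTheory.ae_restrict_iff' measurableSet_Icc).2 (.of_forall hM)

theorem intervalIntegrable (hf : PiecewiseContinuous T f) {a b : ℝ} (ha : a ∈ Icc 0 T)
    (hb : b ∈ Icc 0 T) : IntervalIntegrable f MeasureTheory.volume a b :=
  (hf.integrableOn.mono_set (uIcc_subset_Icc ha hb)).intervalIntegrable

end PiecewiseContinuous

/-- A power curve: piecewise continuous and nonnegative on `[0, T]`. -/
structure IsPowerCurve (T : ℝ) (p : ℝ → ℝ) : Prop where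
  piecewiseContinuous : PiecewiseContinuous T p
  nonneg : ∀ t ∈ Icc 0 T, 0 ≤ p t

/-- The curve that equals `f` up to time `a` and `g` afterwards. -/
noncomputable def splice (a : ℝ) (f g : ℝ → ℝ) (t : ℝ) : ℝ := if t ≤ a then f t else g t

theorem PiecewiseContinuous.splice {T a : ℝ} {f g : ℝ → ℝ} (hf : PiecewiseContinuous T f)
    (hg : PiecewiseContinuous T g) : PiecewiseContinuous T (splice a f g) := by
  have hlt : ∀ x < a, _root_.splice a f g =ᶠ[𝓝 x] f := fun x hx => by
    filter_upwards [Iio_mem_nhds hx] with y hy using if_pos (le_of_lt hy)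
  have hgt : ∀ x, a < x → _root_.splice a f g =ᶠ[𝓝 x] g := fun x hx => by
    filter_upwards [Ioi_mem_nhds hx] with y hy using if_neg (not_le.2 hy)
  refine ⟨?_, fun s hs => ?_, fun s hs => ?_⟩
  · obtain ⟨S, hS, hc⟩ := hf.continuousOn
    obtain ⟨S', hS', hc'⟩ := hg.continuousOn
    refine ⟨insert a (S ∪ S'), (hS.union hS').insert a, fun x hx => ?_⟩
    have hx2 := hx.2
    simp only [mem_insert_iff, mem_union, not_or] at hx2
    rcases lt_or_gt_of_ne hx2.1 with h | h
    · exact ((hc x ⟨hx.1, hx2.2.1⟩).mono fun y hy =>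
        ⟨hy.1, fun h => hy.2 (Or.inr (Or.inl h))⟩).congr_of_eventuallyEq
        ((hlt x h).filter_mono nhdsWithin_le_nhds) (if_pos h.le)
    · exact ((hc' x ⟨hx.1, hx2.2.2⟩).mono fun y hy =>
        ⟨hy.1, fun h => hy.2 (Or.inr (Or.inr h))⟩).congr_of_eventuallyEq
        ((hgt x h).filter_mono nhdsWithin_le_nhds) (if_neg (not_le.2 h))
  · rcases lt_or_ge s a with h | h
    · obtain ⟨l, hl⟩ := hf.right_limit s hs
      exact ⟨l, hl.congr' ((hlt s h).filter_mono nhdsWithin_le_nhds).symm⟩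
    · obtain ⟨l, hl⟩ := hg.right_limit s hs
      refine ⟨l, hl.congr' ?_⟩
      filter_upwards [self_mem_nhdsWithin] with y hy
      exact (if_neg (not_le.2 (h.trans_lt hy))).symm
  · rcases le_or_gt s a with h | h
    · obtain ⟨l, hl⟩ := hf.left_limit s hs
      refine ⟨l, hl.congr' ?_⟩
      filter_upwards [self_mem_nhdsWithin] with y hy
      exact (if_pos ((le_of_lt hy).trans h)).symm
    · obtain ⟨l, hl⟩ := hg.left_limit s hs
      exact ⟨l, hl.congr' ((hgt s h).filter_mono nhdsWithin_le_nhds).symm⟩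

namespace IsPowerCurve

variable {T : ℝ} {p q : ℝ → ℝ}

theorem const {c : ℝ} (hc : 0 ≤ c) : IsPowerCurve T fun _ => c :=
  ⟨PiecewiseContinuous.const c, fun _ _ => hc⟩

theorem splice {a : ℝ} (hp : IsPowerCurve T p) (hq : IsPowerCurve T q) :
    IsPowerCurve T (splice a p q) := by
  refine ⟨hp.1.splice hq.1, fun t ht => ?_⟩
  unfold _root_.splice
  split_ifs
  exacts [hp.2 t ht, hq.2 t ht]

/-! ### Cumulative curves -/

theorem energyCurve_sub (hp : IsPowerCurve T p) {a b : ℝ} (ha : a ∈ Icc 0 T) (hb : b ∈ Icc 0 T) :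
    energyCurve p b - energyCurve p a = ∫ τ in a..b, p τ := by
  have h0 : (0 : ℝ) ∈ Icc 0 T := ⟨le_rfl, ha.1.trans ha.2⟩
  exact intervalIntegral.integral_interval_sub_left (hp.1.intervalIntegrable h0 hb)
    (hp.1.intervalIntegrable h0 ha)

theorem energyCurve_mono (hp : IsPowerCurve T p) {a b : ℝ} (ha : 0 ≤ a) (hab : a ≤ b)
    (hb : b ≤ T) : energyCurve p a ≤ energyCurve p b := by
  have := hp.energyCurve_sub ⟨ha, hab.trans hb⟩ ⟨ha.trans hab, hb⟩
  have h2 : 0 ≤ ∫ τ in a..b, p τ := intervalIntegral.integral_nonneg hab fun u hu =>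
    hp.2 u ⟨ha.trans hu.1, hu.2.trans hb⟩
  linarith

theorem energyCurve_nonneg (hp : IsPowerCurve T p) {t : ℝ} (ht : t ∈ Icc 0 T) :
    0 ≤ energyCurve p t := by
  have := hp.energyCurve_mono le_rfl ht.1 ht.2
  rwa [show energyCurve p 0 = 0 from intervalIntegral.integral_same] at this

theorem energyCurve_lipschitz (hp : IsPowerCurve T p) :
    ∃ K, 0 ≤ K ∧ ∀ a ∈ Icc 0 T, ∀ b ∈ Icc 0 T, a ≤ b →
      energyCurve p b - energyCurve p a ≤ K * (b - a) := by
  obtain ⟨K, hK⟩ := hp.1.exists_bound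
  refine ⟨|K|, abs_nonneg K, fun a ha b hb hab => ?_⟩
  rw [hp.energyCurve_sub ha hb]
  have := intervalIntegral.integral_mono_on hab (hp.1.intervalIntegrable ha hb)
    (intervalIntegrable_const (c := |K|)) fun x hx =>
      ((le_abs_self _).trans (hK x ⟨ha.1.trans hx.1, hx.2.trans hb.2⟩)).trans (le_abs_self K)
  simpa [mul_comm] using this

theorem continuousOn_energyCurve (hp : IsPowerCurve T p) :
    ContinuousOn (energyCurve p) (Icc 0 T) := by
  rcases le_or_gt 0 T with h | h
  · have := intervalIntegral.continuousOn_primitive_interval (f := p) (a := 0) (b := T)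
      (μ := MeasureTheory.volume) (by rw [uIcc_of_le h]; exact hp.1.integrableOn)
    rwa [uIcc_of_le h] at this
  · simp [Icc_eq_empty (not_le.2 h)]

theorem hasDerivAt_energyCurve (hp : IsPowerCurve T p) {t : ℝ} (ht : t ∈ Ioo 0 T)
    (hc : ContinuousAt p t) : HasDerivAt (energyCurve p) (p t) t := by
  have h0 : (0 : ℝ) ∈ Icc 0 T := ⟨le_rfl, ht.1.le.trans ht.2.le⟩
  refine intervalIntegral.integral_hasDerivAt_right
    (hp.1.intervalIntegrable h0 ⟨ht.1.le, ht.2.le⟩) ?_ hc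
  exact ⟨Icc 0 T, Icc_mem_nhds ht.1 ht.2, hp.1.integrableOn.aestronglyMeasurable⟩

/-- Power curves that use no energy between two times transmit with zero power between them. -/
theorem ae_eq_zero (hp : IsPowerCurve T p) {a b : ℝ} (ha : 0 ≤ a) (hab : a ≤ b) (hb : b ≤ T)
    (h : energyCurve p b ≤ energyCurve p a) :
    ∀ᵐ τ ∂MeasureTheory.volume, τ ∈ Ioc a b → p τ = 0 := by
  have hsub := hp.energyCurve_sub ⟨ha, hab.trans hb⟩ ⟨ha.trans hab, hb⟩
  have hmono := hp.energyCurve_mono ha hab hb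
  rw [intervalIntegral.integral_of_le hab] at hsub
  have hnn : 0 ≤ᵐ[MeasureTheory.volume.restrict (Ioc a b)] p :=
    (MeasureTheory.ae_restrict_iff' measurableSet_Ioc).2
      (.of_forall fun x hx => hp.2 x ⟨ha.trans hx.1.le, hx.2.trans hb⟩)
  have hint : MeasureTheory.Integrable p (MeasureTheory.volume.restrict (Ioc a b)) :=
    hp.1.integrableOn.mono_set fun x hx => ⟨ha.trans hx.1.le, hx.2.trans hb⟩
  have := (MeasureTheory.integral_eq_zero_iff_of_nonneg_ae hnn hint).1 (by linarith)
  exact (MeasureTheory.ae_restrict_iff' measurableSet_Ioc).1 this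

end IsPowerCurve

theorem energyCurve_zero (p : ℝ → ℝ) : energyCurve p 0 = 0 := intervalIntegral.integral_same

theorem dataCurve_zero (r p : ℝ → ℝ) : dataCurve r p 0 = 0 := intervalIntegral.integral_same

theorem energyCurve_splice_of_le {a t : ℝ} (p q : ℝ → ℝ) (h0 : 0 ≤ t) (hta : t ≤ a) :
    energyCurve (splice a p q) t = energyCurve p t := by
  refine intervalIntegral.integral_congr fun x hx => ?_
  rw [uIcc_of_le h0] at hx
  exact if_pos (hx.2.trans hta)

theorem energyCurve_splice_of_ge {T a t : ℝ} {p q : ℝ → ℝ} (hp : IsPowerCurve T p)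
    (hq : IsPowerCurve T q) (h0 : 0 ≤ a) (hat : a ≤ t) (htT : t ≤ T) :
    energyCurve (splice a p q) t = energyCurve p a + (energyCurve q t - energyCurve q a) := by
  have ha : a ∈ Icc 0 T := ⟨h0, hat.trans htT⟩
  have ht : t ∈ Icc 0 T := ⟨h0.trans hat, htT⟩
  have h1 := (hp.splice (a := a) hq).energyCurve_sub ha ht
  rw [energyCurve_splice_of_le p q h0 le_rfl] at h1
  have h2 : ∫ τ in a..t, splice a p q τ = ∫ τ in a..t, q τ := by
    refine intervalIntegral.integral_congr_ae (.of_forall fun x hx => ?_)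
    rw [uIoc_of_le hat] at hx
    exact if_neg (not_le.2 hx.1)
  rw [h2, ← hq.energyCurve_sub ha ht] at h1
  linarith

theorem comp_splice (r : ℝ → ℝ) (a : ℝ) (p q : ℝ → ℝ) :
    (fun τ => r (splice a p q τ)) = splice a (fun τ => r (p τ)) fun τ => r (q τ) := by
  funext t
  unfold splice
  split_ifs <;> rfl

theorem energyCurve_const (c t : ℝ) : energyCurve (fun _ => c) t = c * t := by
  simp [energyCurve, mul_comm]

/-! ### Rate functions -/

namespace IsRateFunction

variable {T : ℝ} {r p q : ℝ → ℝ}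

theorem nonneg (hr : IsRateFunction r) {x : ℝ} (hx : 0 ≤ x) : 0 ≤ r x := by
  rw [← hr.zero]
  exact hr.strictMonoOn.monotoneOn (mem_Ici.2 le_rfl) hx hx

theorem mono (hr : IsRateFunction r) {x y : ℝ} (hx : 0 ≤ x) (hxy : x ≤ y) : r x ≤ r y :=
  hr.strictMonoOn.monotoneOn hx (hx.trans hxy) hxy

/-- The rate function, extended by the identity to negative powers, is an order isomorphism
of `ℝ`. -/
theorem exists_orderIso (hr : IsRateFunction r) : ∃ e : ℝ ≃o ℝ, ∀ x, 0 ≤ x → e x = r x := by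
  let f : ℝ → ℝ := fun x => if 0 ≤ x then r x else x
  have hpos : ∀ x, 0 ≤ x → f x = r x := fun x hx => if_pos hx
  have hneg : ∀ x, x < 0 → f x = x := fun x hx => if_neg (not_le.2 hx)
  have hmono : StrictMono f := fun x y hxy => by
    rcases le_or_gt 0 x with hx | hx
    · rw [hpos x hx, hpos y (hx.trans hxy.le)]
      exact hr.strictMonoOn hx (hx.trans hxy.le) hxy
    · rw [hneg x hx]
      rcases le_or_gt 0 y with hy | hy
      · rw [hpos y hy]
        exact hx.trans_le (hr.nonneg hy)
      · rwa [hneg y hy]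
  have hsurj : Function.Surjective f := fun y => by
    rcases le_or_gt 0 y with hy | hy
    · obtain ⟨b, hb⟩ := (hr.tendsto_atTop.eventually_ge_atTop y).and (eventually_ge_atTop 0) |>.exists
      obtain ⟨x, hx, hxy⟩ := intermediate_value_Icc hb.2
        (hr.continuousOn.mono fun x hx => hx.1) (show y ∈ Icc (r 0) (r b) from
          ⟨by rwa [hr.zero], hb.1⟩)
      exact ⟨x, (hpos x hx.1).trans hxy⟩
    · exact ⟨y, hneg y hy⟩
  exact ⟨hmono.orderIsoOfSurjective f hsurj, hpos⟩

/-- The inverse of a rate function: the power that a rate needs. -/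
theorem exists_inverse (hr : IsRateFunction r) : ∃ g : ℝ → ℝ, Continuous g ∧
    (∀ x, 0 ≤ x → g (r x) = x) ∧ ∀ y, 0 ≤ y → 0 ≤ g y ∧ r (g y) = y := by
  obtain ⟨e, he⟩ := hr.exists_orderIso
  have h0 : e.symm 0 = 0 := by
    have := e.symm_apply_apply 0
    rwa [he 0 le_rfl, hr.zero] at this
  have hnn : ∀ y, 0 ≤ y → 0 ≤ e.symm y := fun y hy => by
    rw [← h0]
    exact e.symm.monotone hy
  exact ⟨e.symm, e.symm.continuous, fun x hx => by rw [← he x hx, e.symm_apply_apply],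
    fun y hy => ⟨hnn y hy, by rw [← he _ (hnn y hy), e.apply_symm_apply]⟩⟩

theorem rate (hr : IsRateFunction r) (hp : IsPowerCurve T p) :
    IsPowerCurve T fun τ => r (p τ) := by
  obtain ⟨e, he⟩ := hr.exists_orderIso
  exact ⟨(hp.1.comp e.continuous).congr fun t ht => (he _ (hp.2 t ht)).symm,
    fun t ht => hr.nonneg (hp.2 t ht)⟩

theorem dataCurve_mono (hr : IsRateFunction r) (hp : IsPowerCurve T p) {a b : ℝ} (ha : 0 ≤ a)
    (hab : a ≤ b) (hb : b ≤ T) : dataCurve r p a ≤ dataCurve r p b :=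
  (hr.rate hp).energyCurve_mono ha hab hb

theorem dataCurve_nonneg (hr : IsRateFunction r) (hp : IsPowerCurve T p) {t : ℝ}
    (ht : t ∈ Icc 0 T) : 0 ≤ dataCurve r p t :=
  (hr.rate hp).energyCurve_nonneg ht

theorem continuousOn_dataCurve (hr : IsRateFunction r) (hp : IsPowerCurve T p) :
    ContinuousOn (dataCurve r p) (Icc 0 T) := (hr.rate hp).continuousOn_energyCurve

theorem monotoneOn_dataCurve (hr : IsRateFunction r) (hp : IsPowerCurve T p) :
    MonotoneOn (dataCurve r p) (Icc 0 T) :=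
  fun _ ha _ hb hab => hr.dataCurve_mono hp ha.1 hab hb.2

theorem dataCurve_splice_of_ge (hr : IsRateFunction r) {a t : ℝ} (hp : IsPowerCurve T p)
    (hq : IsPowerCurve T q) (h0 : 0 ≤ a) (hat : a ≤ t) (htT : t ≤ T) :
    dataCurve r (splice a p q) t = dataCurve r p a + (dataCurve r q t - dataCurve r q a) := by
  have := energyCurve_splice_of_ge (hr.rate hp) (hr.rate hq) h0 hat htT
  rwa [← comp_splice] at this

/-- A concave increasing function has positive supergradients at positive points, and they
decrease. -/
theorem exists_supergradient (hr : IsRateFunction r) : ∃ R : ℝ → ℝ,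
    (∀ c, 0 < c → 0 < R c ∧ ∀ x, 0 ≤ x → r x ≤ r c + R c * (x - c)) ∧ AntitoneOn R (Ioi 0) := by
  have key : ∀ c, 0 < c → ∃ m, ∀ x, 0 ≤ x → r x ≤ r c + m * (x - c) := fun c hc => by
    have hslope : ∀ x y, 0 ≤ x → x < c → c < y → (r y - r c) / (y - c) ≤ (r c - r x) / (c - x) :=
      fun x y hx hxc hcy => hr.strictConcaveOn.concaveOn.slope_anti_adjacent hx
        (hc.le.trans hcy.le) hxc hcy
    let A := (fun y => (r y - r c) / (y - c)) '' Ioi c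
    have hne : A.Nonempty := ⟨_, mem_image_of_mem _ (mem_Ioi.2 (lt_add_one c))⟩
    have hbdd : BddAbove A := ⟨(r c - r 0) / (c - 0), by
      rintro _ ⟨y, hy, rfl⟩
      exact hslope 0 y le_rfl hc hy⟩
    refine ⟨sSup A, fun x hx => ?_⟩
    rcases lt_trichotomy x c with h | h | h
    · have h1 : sSup A ≤ (r c - r x) / (c - x) := csSup_le hne (by
        rintro _ ⟨y, hy, rfl⟩
        exact hslope x y hx h hy)
      rw [le_div_iff₀ (by linarith)] at h1
      linarith
    · simp [h]
    · have h1 : (r x - r c) / (x - c) ≤ sSup A := le_csSup hbdd (mem_image_of_mem _ h)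
      rw [div_le_iff₀ (by linarith)] at h1
      linarith
  choose! R hR using key
  refine ⟨R, fun c hc => ⟨?_, hR c hc⟩, fun x hx y hy hxy => ?_⟩
  · have h1 := hR c hc (c + 1) (by linarith)
    have h2 := hr.strictMonoOn (mem_Ici.2 hc.le) (mem_Ici.2 (by linarith : 0 ≤ c + 1)) (by linarith)
    linarith
  · rcases eq_or_lt_of_le hxy with h | h
    · rw [h]
    · have h1 := hR x hx y (le_of_lt hy)
      have h2 := hR y hy x (le_of_lt hx)
      nlinarith

/-- Delivering data at a constant rate is the most energy-efficient way. -/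
theorem energy_ge_of_data_ge (hr : IsRateFunction r) (hp : IsPowerCurve T p) {a b c : ℝ}
    (ha : 0 ≤ a) (hab : a ≤ b) (hb : b ≤ T) (hc : 0 ≤ c)
    (h : r c * (b - a) ≤ dataCurve r p b - dataCurve r p a) :
    c * (b - a) ≤ energyCurve p b - energyCurve p a := by
  rcases eq_or_lt_of_le hc with rfl | hc
  · have := hp.energyCurve_mono ha hab hb
    linarith
  have ha' : a ∈ Icc 0 T := ⟨ha, hab.trans hb⟩
  have hb' : b ∈ Icc 0 T := ⟨ha.trans hab, hb⟩
  obtain ⟨R, hR, -⟩ := hr.exists_supergradient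
  obtain ⟨hpos, hsup⟩ := hR c hc
  have h1 : dataCurve r p b - dataCurve r p a = ∫ τ in a..b, r (p τ) :=
    (hr.rate hp).energyCurve_sub ha' hb'
  have h2 := hp.energyCurve_sub ha' hb'
  have h3 : ∫ τ in a..b, r (p τ) ≤ ∫ τ in a..b, ((r c - R c * c) + R c * p τ) :=
    intervalIntegral.integral_mono_on hab ((hr.rate hp).1.intervalIntegrable ha' hb')
      (intervalIntegrable_const.add ((hp.1.intervalIntegrable ha' hb').const_mul _))
      fun x hx => by
        have := hsup (p x) (hp.2 x ⟨ha.trans hx.1, hx.2.trans hb⟩)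
        linarith
  rw [intervalIntegral.integral_add intervalIntegrable_const
    ((hp.1.intervalIntegrable ha' hb').const_mul _), intervalIntegral.integral_const,
    intervalIntegral.integral_const_mul, smul_eq_mul, ← h2, ← h1] at h3
  have : R c * (c * (b - a)) ≤ R c * (energyCurve p b - energyCurve p a) := by linarith
  exact le_of_mul_le_mul_left this hpos

theorem integral_rate_congr_ae {p q : ℝ → ℝ} {a b : ℝ}
    (h : ∀ᵐ τ ∂MeasureTheory.volume, τ ∈ uIoc a b → p τ = q τ) :
    ∫ τ in a..b, r (p τ) = ∫ τ in a..b, r (q τ) :=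
  intervalIntegral.integral_congr_ae (h.mono fun τ hτ h => by rw [hτ h])

/-- The energy curve is a strictly convex functional of the rate curve: two power curves have a mixture whose
data curve is the weighted mean of theirs and whose energy curve is at most the weighted mean, and
smaller at time `T` unless the data curves agree. -/
theorem exists_mix (hr : IsRateFunction r) (hT : 0 ≤ T) (hp : IsPowerCurve T p)
    (hq : IsPowerCurve T q)
    {l : ℝ} (hl0 : 0 < l) (hl1 : l < 1) : ∃ s, IsPowerCurve T s ∧
      (∀ t ∈ Icc 0 T, dataCurve r s t = (1 - l) * dataCurve r p t + l * dataCurve r q t) ∧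
      (∀ t ∈ Icc 0 T, energyCurve s t ≤ (1 - l) * energyCurve p t + l * energyCurve q t) ∧
      (¬ EqOn (dataCurve r p) (dataCurve r q) (Icc 0 T) →
        energyCurve s T < (1 - l) * energyCurve p T + l * energyCurve q T) := by
  obtain ⟨g, hgc, hgr, hrg⟩ := hr.exists_inverse
  let s : ℝ → ℝ := fun τ => g ((1 - l) * r (p τ) + l * r (q τ))
  have h0 : (0 : ℝ) ∈ Icc 0 T := ⟨le_rfl, hT⟩
  have hTT : T ∈ Icc 0 T := ⟨hT, le_rfl⟩
  have hnn : ∀ t ∈ Icc 0 T, 0 ≤ (1 - l) * r (p t) + l * r (q t) := fun t ht => by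
    have h1 := hr.nonneg (hp.2 t ht)
    have h2 := hr.nonneg (hq.2 t ht)
    have : 0 ≤ 1 - l := by linarith
    positivity
  have hs : IsPowerCurve T s := ⟨(hr.rate hp).1.comp₂ (φ := fun x => g ((1 - l) * x.1 + l * x.2))
    (by fun_prop) (hr.rate hq).1, fun t ht => (hrg _ (hnn t ht)).1⟩
  have hrs : ∀ t ∈ Icc 0 T, r (s t) = (1 - l) * r (p t) + l * r (q t) := fun t ht =>
    (hrg _ (hnn t ht)).2
  -- pointwise concavity of the rate function
  have hsp : ∀ t ∈ Icc 0 T, s t ≤ (1 - l) * p t + l * q t ∧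
      (s t = (1 - l) * p t + l * q t → p t = q t) := fun t ht => by
    have hpt := hp.2 t ht
    have hqt := hq.2 t ht
    have h1 : 0 ≤ 1 - l := by linarith
    have hm : 0 ≤ (1 - l) * p t + l * q t := by positivity
    refine ⟨?_, fun h => ?_⟩
    · have h2 := hr.strictConcaveOn.concaveOn.2 (mem_Ici.2 hpt) (mem_Ici.2 hqt) h1 hl0.le
        (by ring)
      simp only [smul_eq_mul] at h2
      rw [← hrs t ht] at h2
      exact (hr.strictMonoOn.le_iff_le (mem_Ici.2 (hs.2 t ht)) (mem_Ici.2 hm)).1 h2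
    · by_contra hne
      have h2 := hr.strictConcaveOn.2 (mem_Ici.2 hpt) (mem_Ici.2 hqt) hne
        (by linarith : 0 < 1 - l) hl0 (by ring)
      simp only [smul_eq_mul] at h2
      rw [← hrs t ht, h] at h2
      exact lt_irrefl _ h2
  have hIp := fun t (ht : t ∈ Icc 0 T) => hp.1.intervalIntegrable h0 ht
  have hIq := fun t (ht : t ∈ Icc 0 T) => hq.1.intervalIntegrable h0 ht
  have hlin : ∀ t ∈ Icc 0 T, ∫ τ in (0 : ℝ)..t, ((1 - l) * p τ + l * q τ) =
      (1 - l) * energyCurve p t + l * energyCurve q t := fun t ht => by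
    rw [intervalIntegral.integral_add ((hIp t ht).const_mul _) ((hIq t ht).const_mul _),
      intervalIntegral.integral_const_mul, intervalIntegral.integral_const_mul]
    rfl
  have hle : ∀ t ∈ Icc 0 T, energyCurve s t ≤ (1 - l) * energyCurve p t + l * energyCurve q t :=
    fun t ht => by
      rw [← hlin t ht]
      exact intervalIntegral.integral_mono_on ht.1 (hs.1.intervalIntegrable h0 ht)
        (((hIp t ht).const_mul _).add ((hIq t ht).const_mul _))
        fun x hx => (hsp x ⟨hx.1, hx.2.trans ht.2⟩).1
  refine ⟨s, hs, fun t ht => ?_, hle, fun hne => lt_of_le_of_ne (hle T hTT) fun heq => hne ?_⟩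
  · have h1 : dataCurve r s t = ∫ τ in (0 : ℝ)..t, ((1 - l) * r (p τ) + l * r (q τ)) := by
      refine intervalIntegral.integral_congr fun x hx => ?_
      rw [uIcc_of_le ht.1] at hx
      exact hrs x ⟨hx.1, hx.2.trans ht.2⟩
    rw [h1, intervalIntegral.integral_add (((hr.rate hp).1.intervalIntegrable h0 ht).const_mul _)
      (((hr.rate hq).1.intervalIntegrable h0 ht).const_mul _),
      intervalIntegral.integral_const_mul, intervalIntegral.integral_const_mul]
    rfl
  · -- the nonnegative gap between the two sides has integral zero, so the powers agree
    let d : ℝ → ℝ := fun τ => ((1 - l) * p τ + l * q τ) - s τ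
    have hId : IntervalIntegrable d MeasureTheory.volume 0 T :=
      (((hIp T hTT).const_mul _).add ((hIq T hTT).const_mul _)).sub
        (hs.1.intervalIntegrable h0 hTT)
    have hd0 : ∫ τ in (0 : ℝ)..T, d τ = 0 := by
      rw [intervalIntegral.integral_sub (((hIp T hTT).const_mul _).add ((hIq T hTT).const_mul _))
        (hs.1.intervalIntegrable h0 hTT), hlin T hTT, ← heq]
      exact sub_self _
    rw [intervalIntegral.integral_of_le hT] at hd0
    have hdn : 0 ≤ᵐ[MeasureTheory.volume.restrict (Ioc 0 T)] d :=
      (MeasureTheory.ae_restrict_iff' measurableSet_Ioc).2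
        (.of_forall fun x hx => sub_nonneg.2 (hsp x ⟨hx.1.le, hx.2⟩).1)
    have hae := (MeasureTheory.ae_restrict_iff' measurableSet_Ioc).1
      ((MeasureTheory.integral_eq_zero_iff_of_nonneg_ae hdn hId.1).1 hd0)
    intro t ht
    refine integral_rate_congr_ae (hae.mono fun x hx hx' => ?_)
    rw [uIoc_of_le ht.1] at hx'
    have hx1 : x ∈ Ioc 0 T := ⟨hx'.1, hx'.2.trans ht.2⟩
    exact (hsp x ⟨hx1.1.le, hx1.2⟩).2 (sub_eq_zero.1 (hx hx1)).symm

end IsRateFunction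

/-! ### Continuous and convex functions on an interval -/

/-- A point where a continuous function is positive lies in an open interval on which it is positive
and at whose ends it vanishes, provided that it is nonpositive at the ends of its domain. -/
theorem exists_positive_component {f : ℝ → ℝ} {a b t : ℝ} (hf : ContinuousOn f (Icc a b))
    (ht : t ∈ Icc a b) (ha : f a ≤ 0) (hb : f b ≤ 0) (hft : 0 < f t) :
    ∃ α β, a ≤ α ∧ α < t ∧ t < β ∧ β ≤ b ∧ f α = 0 ∧ f β = 0 ∧ ∀ x ∈ Ioo α β, 0 < f x := by
  have hL : ContinuousOn f (Icc a t) := hf.mono (Icc_subset_Icc_right ht.2)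
  have hR : ContinuousOn f (Icc t b) := hf.mono (Icc_subset_Icc_left ht.1)
  obtain ⟨α, ⟨⟨hα, hα0⟩, hαmax⟩⟩ := (isCompact_Icc.of_isClosed_subset
    (hL.preimage_isClosed_of_isClosed isClosed_Icc isClosed_Iic) inter_subset_left).exists_isGreatest
    (s := Icc a t ∩ f ⁻¹' Iic 0) ⟨a, ⟨le_rfl, ht.1⟩, ha⟩
  obtain ⟨β, ⟨⟨hβ, hβ0⟩, hβmin⟩⟩ := (isCompact_Icc.of_isClosed_subset
    (hR.preimage_isClosed_of_isClosed isClosed_Icc isClosed_Iic) inter_subset_left).exists_isLeast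
    (s := Icc t b ∩ f ⁻¹' Iic 0) ⟨b, ⟨ht.2, le_rfl⟩, hb⟩
  have hαt : α < t := lt_of_le_of_ne hα.2 fun h => by
    rw [h] at hα0
    exact absurd hα0 (not_le.2 hft)
  have hβt : t < β := lt_of_le_of_ne hβ.1 fun h => by
    rw [← h] at hβ0
    exact absurd hβ0 (not_le.2 hft)
  have hpos : ∀ x ∈ Ioo α β, 0 < f x := fun x hx => by
    by_contra hneg
    rcases le_total x t with h | h
    · exact absurd (hαmax ⟨⟨hα.1.trans hx.1.le, h⟩, not_lt.1 hneg⟩) (not_le.2 hx.1)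
    · exact absurd (hβmin ⟨⟨h, hx.2.le.trans hβ.2⟩, not_lt.1 hneg⟩) (not_le.2 hx.2)
  have hcl : ∀ x ∈ Icc α β, 0 ≤ f x := fun x hx => by
    have hc : ContinuousOn f (Icc α β) := hf.mono (Icc_subset_Icc hα.1 hβ.2)
    rw [← closure_Ioo (hαt.trans hβt).ne] at hc hx
    exact le_on_closure (f := fun _ => (0 : ℝ)) (fun y hy => (hpos y hy).le) continuousOn_const hc hx
  have hαβ := (hαt.trans hβt).le
  exact ⟨α, β, hα.1, hαt, hβt, hβ.2, le_antisymm hα0 (hcl α ⟨le_rfl, hαβ⟩),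
    le_antisymm hβ0 (hcl β ⟨hαβ, le_rfl⟩), hpos⟩

/-- `f` is affine on `[a, b]`: it is equal to its chord, whose equation is multiplied by `b - a` to
avoid division. -/
def IsAffineOn (f : ℝ → ℝ) (a b : ℝ) : Prop :=
  ∀ t ∈ Icc a b, (b - a) * f t = (b - t) * f a + (t - a) * f b

theorem convexOn_Icc_iff {f : ℝ → ℝ} {T : ℝ} : ConvexOn ℝ (Icc 0 T) f ↔
    ∀ a t b, 0 ≤ a → a < t → t < b → b ≤ T →
      (b - a) * f t ≤ (b - t) * f a + (t - a) * f b := by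
  constructor
  · intro h a t b ha hat htb hb
    have := h.slope_mono_adjacent ⟨ha, (hat.trans htb).le.trans hb⟩
      ⟨ha.trans (hat.trans htb).le, hb⟩ hat htb
    rw [div_le_div_iff₀ (by linarith) (by linarith)] at this
    linarith
  · intro h
    refine convexOn_of_slope_mono_adjacent (convex_Icc 0 T) fun {x y z} hx hz hxy hyz => ?_
    rw [div_le_div_iff₀ (by linarith) (by linarith)]
    have := h x y z hx.1 hxy hyz hz.2
    linarith

/-- A convex function that is equal to an affine function from above at an interior point. -/
theorem IsAffineOn.of_convexOn_touch {f ℓ : ℝ → ℝ} {T a b t : ℝ} (hf : ConvexOn ℝ (Icc 0 T) f)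
    (hℓ : IsAffineOn ℓ a b) (ha : 0 ≤ a) (hat : a < t) (htb : t < b) (hb : b ≤ T)
    (hle : ∀ x ∈ Icc a b, f x ≤ ℓ x) (heq : f t = ℓ t) : ∀ x ∈ Icc a b, f x = ℓ x := by
  rw [convexOn_Icc_iff] at hf
  intro x hx
  refine le_antisymm (hle x hx) ?_
  have hab : 0 < b - a := by linarith
  have h1 := hℓ x hx
  have h2 := hℓ t ⟨hat.le, htb.le⟩
  have ha' := hle a ⟨le_rfl, by linarith⟩
  have hb' := hle b ⟨by linarith, le_rfl⟩
  rcases lt_trichotomy x t with h | h | h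
  · have h3 := hf x t b (ha.trans hx.1) h htb hb
    rw [heq] at h3
    have h4 : (b - x) * ℓ t = (b - t) * ℓ x + (t - x) * ℓ b :=
      mul_left_cancel₀ hab.ne' (by linear_combination (b - x) * h2 - (b - t) * h1)
    have h5 : (t - x) * f b ≤ (t - x) * ℓ b := mul_le_mul_of_nonneg_left hb' (by linarith)
    have h6 : (b - t) * ℓ x ≤ (b - t) * f x := by linarith
    exact le_of_mul_le_mul_left h6 (by linarith)
  · rw [h, heq]
  · have h3 := hf a t x ha hat h (hx.2.trans hb)
    rw [heq] at h3
    have h4 : (x - a) * ℓ t = (x - t) * ℓ a + (t - a) * ℓ x :=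
      mul_left_cancel₀ hab.ne' (by linear_combination (x - a) * h2 - (t - a) * h1)
    have h5 : (x - t) * f a ≤ (x - t) * ℓ a := mul_le_mul_of_nonneg_left ha' (by linarith)
    have h6 : (t - a) * ℓ x ≤ (t - a) * f x := by linarith
    exact le_of_mul_le_mul_left h6 (by linarith)

/-- A convex function lies below an affine function on an interval if it does so at both ends. -/
theorem IsAffineOn.le_of_convexOn {f ℓ : ℝ → ℝ} {T a b t : ℝ} (hf : ConvexOn ℝ (Icc 0 T) f)
    (hℓ : IsAffineOn ℓ a b) (ha : 0 ≤ a) (hat : a < t) (htb : t < b) (hb : b ≤ T)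
    (hfa : f a ≤ ℓ a) (hfb : f b ≤ ℓ b) : f t ≤ ℓ t := by
  have h1 := convexOn_Icc_iff.1 hf a t b ha hat htb hb
  have h2 := hℓ t ⟨hat.le, htb.le⟩
  have h3 : (b - t) * f a ≤ (b - t) * ℓ a := mul_le_mul_of_nonneg_left hfa (by linarith)
  have h4 : (t - a) * f b ≤ (t - a) * ℓ b := mul_le_mul_of_nonneg_left hfb (by linarith)
  have h5 : (b - a) * f t ≤ (b - a) * ℓ t := by linarith
  exact le_of_mul_le_mul_left h5 (by linarith)

theorem IsAffineOn.of_Ioo {f : ℝ → ℝ} {a b : ℝ} (hf : ContinuousOn f (Icc a b))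
    (h : ∀ c d, a < c → c < d → d < b → IsAffineOn f c d) : IsAffineOn f a b := by
  intro t ht
  rcases eq_or_lt_of_le ht.1 with rfl | hat
  · ring
  rcases eq_or_lt_of_le ht.2 with rfl | htb
  · ring
  have hfa : ContinuousOn f (Icc a t) := hf.mono (Icc_subset_Icc_right ht.2)
  have hfb : ContinuousOn f (Icc t b) := hf.mono (Icc_subset_Icc_left ht.1)
  have h1 : ∀ c ∈ Ioo a t, (b - c) * f t = (b - t) * f c + (t - c) * f b := fun c hc => by
    have : EqOn (fun d => (d - c) * f t) (fun d => (d - t) * f c + (t - c) * f d) (Icc t b) :=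
      Set.EqOn.of_subset_closure (s := Ioo t b)
        (fun d hd => h c d hc.1 (hc.2.trans hd.1) hd.2 t ⟨hc.2.le, hd.1.le⟩)
        (by fun_prop) (by fun_prop) Ioo_subset_Icc_self (by rw [closure_Ioo htb.ne])
    exact this ⟨htb.le, le_rfl⟩
  have h2 : EqOn (fun c => (b - c) * f t) (fun c => (b - t) * f c + (t - c) * f b) (Icc a t) :=
    Set.EqOn.of_subset_closure (s := Ioo a t) h1
      (by fun_prop) (by fun_prop) Ioo_subset_Icc_self (by rw [closure_Ioo hat.ne])
  exact h2 ⟨le_rfl, hat.le⟩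

theorem exists_pos_le_of_continuousOn {f g : ℝ → ℝ} {a b : ℝ} (hf : ContinuousOn f (Icc a b))
    (hg : ContinuousOn g (Icc a b)) (h : ∀ t ∈ Icc a b, f t < g t) :
    ∃ ε, 0 < ε ∧ ∀ t ∈ Icc a b, f t + ε ≤ g t := by
  rcases (Icc a b).eq_empty_or_nonempty with he | hne
  · exact ⟨1, one_pos, by simp [he]⟩
  obtain ⟨x, hx, hmin⟩ := isCompact_Icc.exists_isMinOn hne (hg.sub hf)
  refine ⟨g x - f x, sub_pos.2 (h x hx), fun t ht => ?_⟩
  have : g x - f x ≤ g t - f t := hmin ht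
  linarith

theorem exists_lt_on_left {f g : ℝ → ℝ} {T t : ℝ} (hf : ContinuousOn f (Icc 0 T))
    (hg : ContinuousOn g (Icc 0 T)) (ht0 : 0 < t) (htT : t ≤ T) (h : f t < g t) :
    ∃ s, 0 < s ∧ s < t ∧ ∀ u ∈ Icc s t, f u < g u := by
  have ht : t ∈ Icc 0 T := ⟨ht0.le, htT⟩
  have hev : ∀ᶠ u in 𝓝[Icc 0 T] t, f u < g u := (hf t ht).eventually_lt (hg t ht) h
  have hle : 𝓝[<] t ≤ 𝓝[Icc 0 T] t := by
    refine nhdsWithin_le_of_mem ?_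
    filter_upwards [Ioo_mem_nhdsLT ht0] with u hu using ⟨hu.1.le, hu.2.le.trans htT⟩
  obtain ⟨l, hl, hsub⟩ := (mem_nhdsLT_iff_exists_Ioo_subset' ht0).1 (hle hev)
  rw [mem_Iio] at hl
  have h1 : max l 0 < t := max_lt hl ht0
  refine ⟨(max l 0 + t) / 2, ?_, by linarith, fun u hu => ?_⟩
  · have := le_max_right l 0
    linarith
  · rcases eq_or_lt_of_le hu.2 with rfl | hlt
    · exact h
    · have := le_max_left l 0
      exact hsub ⟨by linarith [hu.1], hlt⟩

/-! ### Optimal power curves of the point-to-point problem -/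

theorem PtPFeasible.isPowerCurve {r E B p : ℝ → ℝ} {T : ℝ} (h : PtPFeasible r E B T p) :
    IsPowerCurve T p := ⟨h.piecewiseContinuous, h.nonneg⟩

/-- Holding the power at `x` during `[c, d]`. -/
theorem IsRateFunction.exists_hold {r p : ℝ → ℝ} {T c d x : ℝ} (hr : IsRateFunction r)
    (hp : IsPowerCurve T p) (hc : 0 ≤ c) (hcd : c ≤ d) (hd : d ≤ T) (hx : 0 ≤ x) :
    ∃ q, IsPowerCurve T q ∧
      (∀ t, 0 ≤ t → t ≤ c → energyCurve q t = energyCurve p t ∧ dataCurve r q t = dataCurve r p t) ∧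
      (∀ t, c ≤ t → t ≤ d → energyCurve q t = energyCurve p c + x * (t - c) ∧
        dataCurve r q t = dataCurve r p c + r x * (t - c)) ∧
      (∀ t, d ≤ t → t ≤ T →
        energyCurve q t = energyCurve p c + x * (d - c) + (energyCurve p t - energyCurve p d) ∧
        dataCurve r q t =
          dataCurve r p c + r x * (d - c) + (dataCurve r p t - dataCurve r p d)) := by
  have hK : IsPowerCurve T fun _ => x := IsPowerCurve.const hx
  have hinner : IsPowerCurve T (splice d (fun _ => x) p) := hK.splice hp
  have hlow : ∀ {f f' : ℝ → ℝ} (t : ℝ), 0 ≤ t → t ≤ c →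
      energyCurve (splice c f f') t = energyCurve f t :=
    fun t h0 h => energyCurve_splice_of_le _ _ h0 h
  have hmid : ∀ {f : ℝ → ℝ} {y : ℝ}, IsPowerCurve T f → 0 ≤ y → ∀ t, c ≤ t → t ≤ d →
      energyCurve (splice c f (splice d (fun _ => y) f)) t = energyCurve f c + y * (t - c) := by
    intro f y hf hy t h1 h2
    rw [energyCurve_splice_of_ge hf ((IsPowerCurve.const hy).splice hf) hc h1 (h2.trans hd),
      energyCurve_splice_of_le _ _ (hc.trans h1) h2, energyCurve_splice_of_le _ _ hc hcd,
      energyCurve_const, energyCurve_const]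
    ring
  have hhigh : ∀ {f : ℝ → ℝ} {y : ℝ}, IsPowerCurve T f → 0 ≤ y → ∀ t, d ≤ t → t ≤ T →
      energyCurve (splice c f (splice d (fun _ => y) f)) t =
        energyCurve f c + y * (d - c) + (energyCurve f t - energyCurve f d) := by
    intro f y hf hy t h1 h2
    rw [energyCurve_splice_of_ge hf ((IsPowerCurve.const hy).splice hf) hc (hcd.trans h1) h2,
      energyCurve_splice_of_ge (IsPowerCurve.const hy) hf (hc.trans hcd) h1 h2,
      energyCurve_splice_of_le _ _ hc hcd, energyCurve_const, energyCurve_const]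
    ring
  have hdata : dataCurve r (splice c p (splice d (fun _ => x) p)) =
      energyCurve (splice c (fun τ => r (p τ)) (splice d (fun _ => r x) fun τ => r (p τ))) := by
    funext t
    rw [← comp_splice r d (fun _ => x) p, ← comp_splice]
    rfl
  refine ⟨splice c p (splice d (fun _ => x) p), hp.splice hinner, fun t h0 h => ?_,
    fun t h1 h2 => ?_, fun t h1 h2 => ?_⟩
  · rw [hdata]
    exact ⟨hlow t h0 h, hlow t h0 h⟩
  · rw [hdata]
    exact ⟨hmid hp hx t h1 h2, hmid (hr.rate hp) (hr.nonneg hx) t h1 h2⟩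
  · rw [hdata]
    exact ⟨hhigh hp hx t h1 h2, hhigh (hr.rate hp) (hr.nonneg hx) t h1 h2⟩

namespace PtPOptimal

variable {r E B p q : ℝ → ℝ} {T : ℝ}

theorem isPowerCurve (h : PtPOptimal r E B T p) : IsPowerCurve T p := h.feasible.isPowerCurve

/-- The variational inequality of the convex program: a competitor `q` may exceed the optimal
curves wherever these have slack `ε`, because only a small fraction of `q` is mixed in. -/
theorem perturb (hr : IsRateFunction r) (hT : 0 ≤ T) (h : PtPOptimal r E B T p)
    (hq : IsPowerCurve T q) {ε : ℝ} (hε : 0 < ε)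
    (hE : ∀ t ∈ Icc 0 T, energyCurve q t ≤ energyCurve p t ∨ energyCurve p t + ε ≤ E t)
    (hD : ∀ t ∈ Icc 0 T, dataCurve r q t ≤ dataCurve r p t ∨ dataCurve r p t + ε ≤ B t) :
    dataCurve r q T ≤ dataCurve r p T ∧
      (dataCurve r q T = dataCurve r p T → energyCurve q T ≤ energyCurve p T →
        EqOn (dataCurve r p) (dataCurve r q) (Icc 0 T)) := by
  have hp := h.isPowerCurve
  have hTT : T ∈ Icc 0 T := ⟨hT, le_rfl⟩
  have hEn := hq.energyCurve_nonneg hTT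
  have hDn := hr.dataCurve_nonneg hq hTT
  have hden : 0 < energyCurve q T + dataCurve r q T + 1 := by linarith
  let l := min (1 / 2) (ε / (energyCurve q T + dataCurve r q T + 1))
  have hl0 : 0 < l := lt_min (by norm_num) (by positivity)
  have hl1 : l < 1 := (min_le_left _ _).trans_lt (by norm_num)
  have hl2 : l * (energyCurve q T + dataCurve r q T + 1) ≤ ε := by
    rw [← le_div_iff₀ hden]
    exact min_le_right _ _
  obtain ⟨s, hs, hsD, hsE, hslt⟩ := hr.exists_mix hT hp hq hl0 hl1
  have hfeas : PtPFeasible r E B T s := by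
    refine ⟨hs.1, hs.2, fun t ht => (hsE t ht).trans ?_, fun t ht => (hsD t ht).le.trans ?_⟩
    · have h1 := h.feasible.energy_causal t ht
      rcases hE t ht with h2 | h2
      · nlinarith
      · have h3 := hq.energyCurve_mono ht.1 ht.2 le_rfl
        have h4 := hp.energyCurve_nonneg ht
        nlinarith
    · have h1 := h.feasible.data_causal t ht
      rcases hD t ht with h2 | h2
      · nlinarith
      · have h3 := hr.dataCurve_mono hq ht.1 ht.2 le_rfl
        have h4 := hr.dataCurve_nonneg hp ht
        nlinarith
  have hmax := h.throughput_max s hfeas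
  rw [hsD T hTT] at hmax
  refine ⟨by nlinarith, fun hDT hET => ?_⟩
  by_contra hne
  have h1 := h.energy_min s hfeas (by rw [hsD T hTT, hDT]; ring)
  have h2 := hslt hne
  nlinarith

/-- If on `[c, d]` the optimal data curve is, at each time, above its chord or has slack together
with the energy curve, then it is equal to the chord: holding the power constant would save
energy. -/
theorem isAffineOn (hr : IsRateFunction r) (hT : 0 ≤ T) (h : PtPOptimal r E B T p) {c d ε : ℝ}
    (hc : 0 ≤ c) (hcd : c < d) (hd : d ≤ T) (hε : 0 < ε)
    (hcases : ∀ t ∈ Ioo c d,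
      (d - t) * dataCurve r p c + (t - c) * dataCurve r p d ≤ (d - c) * dataCurve r p t ∨
      (energyCurve p t + ε ≤ E t ∧ dataCurve r p t + ε ≤ B t)) :
    IsAffineOn (dataCurve r p) c d := by
  have hp := h.isPowerCurve
  have hdc : 0 < d - c := sub_pos.2 hcd
  obtain ⟨g, -, -, hrg⟩ := hr.exists_inverse
  have hm : 0 ≤ (dataCurve r p d - dataCurve r p c) / (d - c) :=
    div_nonneg (sub_nonneg.2 (hr.dataCurve_mono hp hc hcd.le hd)) hdc.le
  obtain ⟨hx, hrx⟩ := hrg _ hm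
  set x := g ((dataCurve r p d - dataCurve r p c) / (d - c))
  have hrx' : r x * (d - c) = dataCurve r p d - dataCurve r p c := by
    rw [hrx]
    field_simp
  obtain ⟨q, hq, hlow, hmid, hhigh⟩ := hr.exists_hold hp hc hcd.le hd hx
  have hsave := hr.energy_ge_of_data_ge hp hc hcd.le hd hx hrx'.le
  have houtE : ∀ t ∈ Icc 0 T, t ∉ Ioo c d → energyCurve q t ≤ energyCurve p t ∧
      dataCurve r q t = dataCurve r p t := fun t ht hn => by
    rcases le_or_gt t c with h1 | h1
    · exact ⟨(hlow t ht.1 h1).1.le, (hlow t ht.1 h1).2⟩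
    · have h2 : d ≤ t := not_lt.1 fun h2 => hn ⟨h1, h2⟩
      obtain ⟨h3, h4⟩ := hhigh t h2 ht.2
      constructor <;> linarith
  have hchord : ∀ t ∈ Ioo c d,
      (d - t) * dataCurve r p c + (t - c) * dataCurve r p d ≤ (d - c) * dataCurve r p t →
      r x * (t - c) ≤ dataCurve r p t - dataCurve r p c := fun t ht hle => by
    refine le_of_mul_le_mul_left (a := d - c) ?_ hdc
    linear_combination hle + (t - c) * hrx'
  obtain ⟨-, heq⟩ := h.perturb hr hT hq hε
    (fun t ht => by
      by_cases hn : t ∈ Ioo c d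
      · refine (hcases t hn).imp (fun hle => ?_) And.left
        have := hr.energy_ge_of_data_ge hp hc hn.1.le ht.2 hx (hchord t hn hle)
        rw [(hmid t hn.1.le hn.2.le).1]
        linarith
      · exact Or.inl (houtE t ht hn).1)
    (fun t ht => by
      by_cases hn : t ∈ Ioo c d
      · refine (hcases t hn).imp (fun hle => ?_) And.right
        have := hchord t hn hle
        rw [(hmid t hn.1.le hn.2.le).2]
        linarith
      · exact Or.inl (houtE t ht hn).2.le)
  have hTn : T ∉ Ioo c d := fun h => absurd h.2 (not_lt.2 hd)
  have heq := heq (houtE T ⟨hT, le_rfl⟩ hTn).2 (houtE T ⟨hT, le_rfl⟩ hTn).1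
  intro t ht
  have h1 := heq ⟨hc.trans ht.1, ht.2.trans hd⟩
  rw [(hmid t ht.1 ht.2).2] at h1
  linear_combination (d - c) * h1 + (t - c) * hrx'

/-- The power of an optimal policy never decreases: saved energy and data can be used later. -/
theorem convexOn_dataCurve (hr : IsRateFunction r) (hT : 0 ≤ T) (h : PtPOptimal r E B T p) :
    ConvexOn ℝ (Icc 0 T) (dataCurve r p) := by
  rw [convexOn_Icc_iff]
  intro a t b ha hat htb hb
  by_contra hlt
  rw [not_le] at hlt
  have hcD : ContinuousOn (dataCurve r p) (Icc a b) :=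
    (hr.continuousOn_dataCurve h.isPowerCurve).mono (Icc_subset_Icc ha hb)
  obtain ⟨α, β, hα, hαt, htβ, hβ, hα0, hβ0, hpos⟩ := exists_positive_component
    (f := fun s => (b - a) * dataCurve r p s -
      ((b - s) * dataCurve r p a + (s - a) * dataCurve r p b)) (a := a) (b := b) (t := t)
    (by fun_prop) ⟨hat.le, htb.le⟩ (by simp) (by simp) (by linarith)
  have hba : 0 < b - a := by linarith
  have haff := h.isAffineOn hr hT (ha.trans hα) (hαt.trans htβ) (hβ.trans hb) one_pos
    fun s hs => Or.inl (le_of_mul_le_mul_left (a := b - a) (by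
      have h1 := mul_nonneg (sub_nonneg.2 (hαt.trans htβ).le) (hpos s hs).le
      linear_combination h1 + (β - s) * hα0 + (s - α) * hβ0) hba)
  have h1 := haff t ⟨hαt.le, htβ.le⟩
  have h2 := mul_pos (sub_pos.2 (hαt.trans htβ)) (hpos t ⟨hαt, htβ⟩)
  have h3 : (β - α) * ((b - a) * dataCurve r p t -
      ((b - t) * dataCurve r p a + (t - a) * dataCurve r p b)) = 0 := by
    linear_combination (b - a) * h1 + (β - t) * hα0 + (t - α) * hβ0
  linarith

/-- Any feasible curve that has delivered as much data as the optimal one has used as much energy,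
and strictly more if it has delivered more data. Otherwise it could be followed up to this time,
followed by silence until the optimal data curve catches up. -/
theorem energy_le_of_data_le (hr : IsRateFunction r) (hE : MonotoneOn E (Icc 0 T))
    (hB : MonotoneOn B (Icc 0 T)) (h : PtPOptimal r E B T p) (hq : PtPFeasible r E B T q) {t : ℝ}
    (ht : t ∈ Icc 0 T) (hD : dataCurve r p t ≤ dataCurve r q t) :
    energyCurve p t ≤ energyCurve q t ∧
      (dataCurve r p t < dataCurve r q t → energyCurve p t < energyCurve q t) := by
  have hp := h.isPowerCurve
  have hqc := hq.isPowerCurve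
  have hZ : IsPowerCurve T fun _ => (0 : ℝ) := IsPowerCurve.const le_rfl
  have hTT : T ∈ Icc 0 T := ⟨ht.1.trans ht.2, le_rfl⟩
  -- the curve that is silent during `[t, s]`
  have key : ∀ s, t ≤ s → s ≤ T → (s = T ∨ dataCurve r q t ≤ dataCurve r p s) →
      energyCurve q t ≤ energyCurve p t → ∃ w, PtPFeasible r E B T w ∧
      energyCurve w T = energyCurve q t + (energyCurve p T - energyCurve p s) ∧
      dataCurve r w T = dataCurve r q t + (dataCurve r p T - dataCurve r p s) := by
    intro s hts hsT hs hEt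
    have hs0 : 0 ≤ s := ht.1.trans hts
    have hin : IsPowerCurve T (splice s (fun _ => 0) p) := hZ.splice hp
    have hw := hqc.splice (a := t) hin
    have hZE : ∀ u, energyCurve (fun _ => (0 : ℝ)) u = 0 := fun u => by simp [energyCurve_const]
    have hZD : ∀ u, dataCurve r (fun _ => (0 : ℝ)) u = 0 := fun u => by
      simp [dataCurve, hr.zero]
    have hlowE : ∀ u, 0 ≤ u → u ≤ t →
        energyCurve (splice t q (splice s (fun _ => 0) p)) u = energyCurve q u :=
      fun u h0 h => energyCurve_splice_of_le _ _ h0 h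
    have hlowD : ∀ (f f' : ℝ → ℝ) (a u : ℝ), 0 ≤ u → u ≤ a →
        dataCurve r (splice a f f') u = dataCurve r f u := fun f f' a u h0 h => by
      have := energyCurve_splice_of_le (fun τ => r (f τ)) (fun τ => r (f' τ)) h0 h
      rwa [← comp_splice] at this
    have hmidE : ∀ u, t ≤ u → u ≤ s →
        energyCurve (splice t q (splice s (fun _ => 0) p)) u = energyCurve q t := fun u h1 h2 => by
      rw [energyCurve_splice_of_ge hqc hin ht.1 h1 (h2.trans hsT),
        energyCurve_splice_of_le _ _ (ht.1.trans h1) h2, energyCurve_splice_of_le _ _ ht.1 hts,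
        hZE, hZE]
      ring
    have hmidD : ∀ u, t ≤ u → u ≤ s →
        dataCurve r (splice t q (splice s (fun _ => 0) p)) u = dataCurve r q t := fun u h1 h2 => by
      rw [hr.dataCurve_splice_of_ge hqc hin ht.1 h1 (h2.trans hsT),
        hlowD _ _ _ _ (ht.1.trans h1) h2, hlowD _ _ _ _ ht.1 hts, hZD, hZD]
      ring
    have hhighE : ∀ u, s ≤ u → u ≤ T → energyCurve (splice t q (splice s (fun _ => 0) p)) u =
        energyCurve q t + (energyCurve p u - energyCurve p s) := fun u h1 h2 => by
      rw [energyCurve_splice_of_ge hqc hin ht.1 (hts.trans h1) h2,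
        energyCurve_splice_of_ge hZ hp hs0 h1 h2, energyCurve_splice_of_le _ _ ht.1 hts, hZE, hZE]
      ring
    have hhighD : ∀ u, s ≤ u → u ≤ T → dataCurve r (splice t q (splice s (fun _ => 0) p)) u =
        dataCurve r q t + (dataCurve r p u - dataCurve r p s) := fun u h1 h2 => by
      rw [hr.dataCurve_splice_of_ge hqc hin ht.1 (hts.trans h1) h2,
        hr.dataCurve_splice_of_ge hZ hp hs0 h1 h2, hlowD _ _ _ _ ht.1 hts, hZD, hZD]
      ring
    refine ⟨_, ⟨hw.1, hw.2, fun u hu => ?_, fun u hu => ?_⟩, hhighE T hsT le_rfl,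
      hhighD T hsT le_rfl⟩
    · rcases le_total u t with h1 | h1
      · rw [hlowE u hu.1 h1]
        exact hq.energy_causal u hu
      rcases le_total u s with h2 | h2
      · rw [hmidE u h1 h2]
        exact (hq.energy_causal t ht).trans (hE ht hu h1)
      · rw [hhighE u h2 hu.2]
        have h3 := h.feasible.energy_causal u hu
        have h4 := hp.energyCurve_mono ht.1 hts hsT
        linarith
    · rcases le_total u t with h1 | h1
      · rw [hlowD _ _ _ _ hu.1 h1]
        exact hq.data_causal u hu
      rcases le_total u s with h2 | h2
      · rw [hmidD u h1 h2]
        exact (hq.data_causal t ht).trans (hB ht hu h1)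
      · rw [hhighD u h2 hu.2]
        rcases hs with rfl | hs
        · rw [le_antisymm hu.2 h2, sub_self, add_zero]
          exact (hq.data_causal t ht).trans (hB ht hTT ht.2)
        · have h3 := h.feasible.data_causal u hu
          linarith
  -- a curve with no more energy at time `t` is caught up, without the optimal curve transmitting
  have main : energyCurve q t ≤ energyCurve p t →
      energyCurve p t ≤ energyCurve q t ∧ dataCurve r q t = dataCurve r p t := fun hEt => by
    have hDT : dataCurve r q t ≤ dataCurve r p T := by
      obtain ⟨w, hw, -, hwD⟩ := key T ht.2 le_rfl (Or.inl rfl) hEt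
      have := h.throughput_max w hw
      linarith
    obtain ⟨s, hs, hsD⟩ := intermediate_value_Icc ht.2
      ((hr.continuousOn_dataCurve hp).mono (Icc_subset_Icc_left ht.1)) ⟨hD, hDT⟩
    obtain ⟨w, hw, hwE, hwD⟩ := key s hs.1 hs.2 (Or.inr hsD.ge) hEt
    have h1 := h.energy_min w hw (by linarith)
    have h2 := hp.energyCurve_mono ht.1 hs.1 hs.2
    refine ⟨by linarith, ?_⟩
    have h3 := hp.ae_eq_zero ht.1 hs.1 hs.2 (by linarith)
    have h4 : dataCurve r p s - dataCurve r p t = ∫ τ in t..s, r (p τ) :=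
      (hr.rate hp).energyCurve_sub ht ⟨ht.1.trans hs.1, hs.2⟩
    rw [IsRateFunction.integral_rate_congr_ae (r := r) (q := fun _ => 0)
      (by rwa [uIoc_of_le hs.1])] at h4
    simp only [hr.zero, intervalIntegral.integral_zero] at h4
    linarith
  refine ⟨?_, fun hlt => ?_⟩
  · by_contra hn
    exact hn (main (not_le.1 hn).le).1
  · by_contra hn
    have := (main (not_lt.1 hn)).2
    linarith

/-- Where a feasible curve is ahead of the optimal one, the optimal one transmits at constant
rate. -/
theorem isAffineOn_of_lt (hr : IsRateFunction r) (hE : MonotoneOn E (Icc 0 T))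
    (hB : MonotoneOn B (Icc 0 T)) (h : PtPOptimal r E B T p) (hq : PtPFeasible r E B T q) {a b : ℝ}
    (ha : 0 ≤ a) (hb : b ≤ T) (hlt : ∀ t ∈ Ioo a b, dataCurve r p t < dataCurve r q t) :
    IsAffineOn (dataCurve r p) a b := by
  have hp := h.isPowerCurve
  have hqc := hq.isPowerCurve
  refine IsAffineOn.of_Ioo
    ((hr.continuousOn_dataCurve hp).mono (Icc_subset_Icc ha hb)) fun c d hc hcd hd => ?_
  have hc0 : 0 ≤ c := ha.trans hc.le
  have hdT : d ≤ T := hd.le.trans hb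
  have hsub : Icc c d ⊆ Icc 0 T := Icc_subset_Icc hc0 hdT
  have hlt' : ∀ t ∈ Icc c d, dataCurve r p t < dataCurve r q t := fun t ht =>
    hlt t ⟨hc.trans_le ht.1, ht.2.trans_lt hd⟩
  obtain ⟨ε, hε, hDε⟩ := exists_pos_le_of_continuousOn
    ((hr.continuousOn_dataCurve hp).mono hsub) ((hr.continuousOn_dataCurve hqc).mono hsub)
    hlt'
  obtain ⟨δ, hδ, hEδ⟩ := exists_pos_le_of_continuousOn
    (hp.continuousOn_energyCurve.mono hsub) (hqc.continuousOn_energyCurve.mono hsub)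
    fun t ht => (h.energy_le_of_data_le hr hE hB hq (hsub ht) (hlt' t ht).le).2 (hlt' t ht)
  refine h.isAffineOn hr (hc0.trans (hcd.le.trans hdT)) hc0 hcd hdT (lt_min hε hδ)
    fun t ht => Or.inr ?_
  have ht' := hsub ⟨ht.1.le, ht.2.le⟩
  have h1 := hDε t ⟨ht.1.le, ht.2.le⟩
  have h2 := hEδ t ⟨ht.1.le, ht.2.le⟩
  have h3 := hq.energy_causal t ht'
  have h4 := hq.data_causal t ht'
  have h5 := min_le_left ε δ
  have h6 := min_le_right ε δ
  constructor <;> linarith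

/-- A time at which a feasible curve is ahead lies between two times at which it meets the optimal
one, and the optimal one transmits at constant rate between them. -/
theorem exists_affine_component (hr : IsRateFunction r) (hE : MonotoneOn E (Icc 0 T))
    (hB : MonotoneOn B (Icc 0 T)) (h : PtPOptimal r E B T p) (hq : PtPFeasible r E B T q) {t : ℝ}
    (ht : t ∈ Icc 0 T) (hlt : dataCurve r p t < dataCurve r q t) :
    ∃ α β, 0 ≤ α ∧ α < t ∧ t < β ∧ β ≤ T ∧ dataCurve r q α = dataCurve r p α ∧
      dataCurve r q β = dataCurve r p β ∧ IsAffineOn (dataCurve r p) α β := by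
  have hcp := hr.continuousOn_dataCurve h.isPowerCurve
  have hcq := hr.continuousOn_dataCurve hq.isPowerCurve
  obtain ⟨α, β, hα, hαt, htβ, hβ, hα0, hβ0, hpos⟩ := exists_positive_component
    (f := fun s => dataCurve r q s - dataCurve r p s) (hcq.sub hcp) ht
    (by simp [dataCurve_zero]) (sub_nonpos.2 (h.throughput_max q hq)) (sub_pos.2 hlt)
  exact ⟨α, β, hα, hαt, htβ, hβ, sub_eq_zero.1 hα0, sub_eq_zero.1 hβ0,
    h.isAffineOn_of_lt hr hE hB hq hα hβ fun s hs => sub_pos.1 (hpos s hs)⟩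

/-- The optimal data curve dominates every convex curve below a feasible data curve. -/
theorem le_dataCurve_of_convexOn (hr : IsRateFunction r) (hE : MonotoneOn E (Icc 0 T))
    (hB : MonotoneOn B (Icc 0 T)) (h : PtPOptimal r E B T p) (hq : PtPFeasible r E B T q)
    {C : ℝ → ℝ} (hC : ConvexOn ℝ (Icc 0 T) C) (hCc : ContinuousOn C (Icc 0 T)) (hC0 : C 0 ≤ 0)
    (hle : ∀ t ∈ Icc 0 T, C t ≤ dataCurve r q t) :
    ∀ t ∈ Icc 0 T, C t ≤ dataCurve r p t := by
  intro t ht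
  by_contra hlt
  rw [not_le] at hlt
  have hcD := hr.continuousOn_dataCurve h.isPowerCurve
  have hT : 0 ≤ T := ht.1.trans ht.2
  obtain ⟨α, β, hα, hαt, htβ, hβ, hα0, hβ0, hpos⟩ := exists_positive_component
    (f := fun s => C s - dataCurve r p s) (a := 0) (b := T) (t := t)
    (by fun_prop) ht (by simpa [dataCurve_zero] using hC0)
    (sub_nonpos.2 ((hle T ⟨hT, le_rfl⟩).trans (h.throughput_max q hq))) (by linarith)
  have haff := h.isAffineOn_of_lt hr hE hB hq hα hβ fun s hs =>
    (sub_pos.1 (hpos s hs)).trans_le (hle s ⟨hα.trans hs.1.le, hs.2.le.trans hβ⟩)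
  have := haff.le_of_convexOn hC hα hαt htβ hβ (by linarith) (by linarith)
  linarith

end PtPOptimal

/-! ### Power curves with a convex data curve -/

/-- A power curve with a convex data curve is almost everywhere equal to a monotone
function `P`. Taking `P` left-continuous makes it constant up to and including the right end of every
interval on which the data curve is affine. -/
theorem IsPowerCurve.exists_monotone {r p : ℝ → ℝ} {T : ℝ} (hr : IsRateFunction r)
    (hp : IsPowerCurve T p) (hconv : ConvexOn ℝ (Icc 0 T) (dataCurve r p)) :
    ∃ P : ℝ → ℝ, Monotone P ∧ (∀ t, 0 ≤ P t) ∧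
      (∀ᵐ τ ∂MeasureTheory.volume, τ ∈ Icc 0 T → p τ = P τ) ∧
      ∀ a b, 0 ≤ a → a < b → b ≤ T → IsAffineOn (dataCurve r p) a b →
        ∀ x ∈ Ioc a b, ∀ y ∈ Ioc a b, P x = P y := by
  obtain ⟨S, hS, hSc⟩ := hp.1.exists_continuousAt
  obtain ⟨S', hS', hSc'⟩ := (hr.rate hp).1.exists_continuousAt
  have hfin : (S ∪ S').Finite := hS.union hS'
  let G : Set ℝ := Ioo 0 T \ (S ∪ S')
  have hGo : IsOpen G := isOpen_Ioo.sdiff hfin.isClosed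
  have hGI : ∀ t ∈ G, t ∈ Icc 0 T := fun t ht => ⟨ht.1.1.le, ht.1.2.le⟩
  have hGc : ∀ t ∈ G, ContinuousAt p t := fun t ht =>
    (hSc t ⟨hGI t ht, fun h => ht.2 (Or.inl h)⟩).2
  have hGd : ∀ t ∈ G, HasDerivAt (dataCurve r p) (r (p t)) t := fun t ht =>
    (hr.rate hp).hasDerivAt_energyCurve ht.1 (hSc' t ⟨hGI t ht, fun h => ht.2 (Or.inr h)⟩).2
  have hmono : MonotoneOn p G := fun s hs t ht hst => by
    rcases eq_or_lt_of_le hst with rfl | hlt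
    · exact le_rfl
    have h1 := hconv.le_slope_of_hasDerivAt (hGI s hs) (hGI t ht) hlt (hGd s hs)
    have h2 := hconv.slope_le_of_hasDerivAt (hGI s hs) (hGI t ht) hlt (hGd t ht)
    exact (hr.strictMonoOn.le_iff_le (hp.2 s (hGI s hs)) (hp.2 t (hGI t ht))).1 (h1.trans h2)
  obtain ⟨M, hM⟩ := hp.1.exists_bound
  obtain ⟨g, hg, hgp⟩ := hmono.exists_monotone_extension
    ⟨0, by rintro _ ⟨t, ht, rfl⟩; exact hp.2 t (hGI t ht)⟩
    ⟨M, by rintro _ ⟨t, ht, rfl⟩; exact (le_abs_self _).trans (hM t (hGI t ht))⟩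
  have hPG : ∀ t ∈ G, Function.leftLim g t = p t := fun t ht => by
    have h1 : p =ᶠ[𝓝 t] g := by
      filter_upwards [hGo.mem_nhds ht] with x hx using hgp hx
    rw [((hGc t ht).congr h1).continuousWithinAt.leftLim_eq, h1.self_of_nhds]
  refine ⟨fun t => max (Function.leftLim g t) 0, hg.leftLim.max monotone_const,
    fun t => le_max_right _ _, ?_, ?_⟩
  · have hnull : ∀ᵐ τ ∂MeasureTheory.volume, τ ∉ insert 0 (insert T (S ∪ S')) :=
      ((hfin.insert T).insert 0).measure_zero MeasureTheory.volume |> fun h =>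
        MeasureTheory.measure_eq_zero_iff_ae_notMem.1 h
    filter_upwards [hnull] with τ hτ hτI
    simp only [mem_insert_iff, not_or] at hτ
    have hτG : τ ∈ G := ⟨⟨lt_of_le_of_ne hτI.1 (Ne.symm hτ.1), lt_of_le_of_ne hτI.2 hτ.2.1⟩, hτ.2.2⟩
    rw [hPG τ hτG, max_eq_left (hp.2 τ hτI)]
  · intro a b ha hab hb haff
    obtain ⟨i, -, hi, -⟩ := hr.exists_inverse
    have hconst : ∀ x ∈ Ioc a b, Function.leftLim g x =
        i ((dataCurve r p b - dataCurve r p a) / (b - a)) := fun x hx => by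
      refine tendsto_nhds_unique (hg.tendsto_leftLim x) (tendsto_const_nhds.congr' ?_)
      have hfin' : ∀ᶠ y in 𝓝[<] x, y ∉ S ∪ S' := by
        have h1 : ((S ∪ S') \ {x})ᶜ ∈ 𝓝 x := (hfin.sdiff.isClosed.isOpen_compl).mem_nhds (by simp)
        filter_upwards [nhdsWithin_le_nhds h1, self_mem_nhdsWithin] with y hy hyx hyS
        exact hy ⟨hyS, ne_of_lt hyx⟩
      filter_upwards [Ioo_mem_nhdsLT hx.1, hfin'] with y hy hyS
      have hyG : y ∈ G := ⟨⟨ha.trans_lt hy.1, hy.2.trans_le (hx.2.trans hb)⟩, hyS⟩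
      have hd : HasDerivAt (dataCurve r p) ((dataCurve r p b - dataCurve r p a) / (b - a)) y := by
        have hlin : HasDerivAt (fun t => dataCurve r p a +
            (dataCurve r p b - dataCurve r p a) / (b - a) * (t - a))
            ((dataCurve r p b - dataCurve r p a) / (b - a)) y := by
          simpa using (((hasDerivAt_id y).sub_const a).const_mul
            ((dataCurve r p b - dataCurve r p a) / (b - a))).const_add (dataCurve r p a)
        refine hlin.congr_of_eventuallyEq ?_
        filter_upwards [Ioo_mem_nhds hy.1 (hy.2.trans_le hx.2)] with t ht
        have h1 := haff t ⟨ht.1.le, ht.2.le⟩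
        have h2 : b - a ≠ 0 := (sub_pos.2 hab).ne'
        field_simp
        linarith
      rw [← hgp hyG, ← hi _ (hp.2 y (hGI y hyG)), (hGd y hyG).unique hd]
    intro x hx y hy
    simp only [hconst x hx, hconst y hy]

/-! ### Sufficiency of the slackness conditions -/

section Sufficiency

variable {r p q P : ℝ → ℝ} {T : ℝ}

/-- One step of the discretized comparison. The last summand is the price for using the
supergradient at a single power `c`, an upper bound of `p` on `[a, b]`. -/
theorem IsRateFunction.data_step_le (hr : IsRateFunction r) (hp : IsPowerCurve T p)
    (hq : IsPowerCurve T q) (hP : Monotone P) (hP0 : ∀ t, 0 ≤ P t)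
    (hpP : ∀ᵐ τ ∂MeasureTheory.volume, τ ∈ Icc 0 T → p τ = P τ) {a b c ρ : ℝ} (ha : 0 ≤ a)
    (hab : a ≤ b) (hb : b ≤ T) (hc : P b ≤ c) (hρ : 0 ≤ ρ)
    (hsup : ∀ x, 0 ≤ x → r x ≤ r c + ρ * (x - c)) :
    (dataCurve r q b - dataCurve r p b) - (dataCurve r q a - dataCurve r p a) ≤
      ρ * ((energyCurve q b - energyCurve p b) - (energyCurve q a - energyCurve p a)) +
        (b - a) * (r c - r (P a)) := by
  have ha' : a ∈ Icc 0 T := ⟨ha, hab.trans hb⟩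
  have hb' : b ∈ Icc 0 T := ⟨ha.trans hab, hb⟩
  have hqi := hq.1.intervalIntegrable ha' hb'
  have hpi := hp.1.intervalIntegrable ha' hb'
  have hrqi := (hr.rate hq).1.intervalIntegrable ha' hb'
  have hrpi := (hr.rate hp).1.intervalIntegrable ha' hb'
  have h1 : dataCurve r q b - dataCurve r q a = ∫ τ in a..b, r (q τ) :=
    (hr.rate hq).energyCurve_sub ha' hb'
  have h2 : dataCurve r p b - dataCurve r p a = ∫ τ in a..b, r (p τ) :=
    (hr.rate hp).energyCurve_sub ha' hb'
  have h3 := hq.energyCurve_sub ha' hb'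
  have h4 := hp.energyCurve_sub ha' hb'
  have h5 : ∫ τ in a..b, (r (q τ) - r (p τ)) ≤
      ∫ τ in a..b, (ρ * (q τ - p τ) + (r c - r (P a))) := by
    refine intervalIntegral.integral_mono_ae_restrict hab (hrqi.sub hrpi)
      (((hqi.sub hpi).const_mul _).add intervalIntegrable_const) ?_
    refine (MeasureTheory.ae_restrict_iff' measurableSet_Icc).2 (hpP.mono fun τ hτ hτI => ?_)
    have hτT : τ ∈ Icc 0 T := ⟨ha.trans hτI.1, hτI.2.trans hb⟩
    have hpτ := hτ hτT
    have h6 := hsup (q τ) (hq.2 τ hτT)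
    have h7 : r (P a) ≤ r (p τ) := by
      rw [hpτ]
      exact hr.mono (hP0 a) (hP hτI.1)
    have h8 : p τ ≤ c := by
      rw [hpτ]
      exact (hP hτI.2).trans hc
    have h9 : 0 ≤ ρ * (c - p τ) := mul_nonneg hρ (by linarith)
    simp only
    linarith
  rw [intervalIntegral.integral_sub hrqi hrpi, intervalIntegral.integral_add
    ((hqi.sub hpi).const_mul _) intervalIntegrable_const, intervalIntegral.integral_const_mul,
    intervalIntegral.integral_sub hqi hpi, intervalIntegral.integral_const, smul_eq_mul,
    ← h1, ← h2, ← h3, ← h4] at h5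
  linarith

/-- A supergradient may be lowered from `ρa` to `ρb` in the invariant `y ≤ ρ * x + e` at a cost
proportional to `ρa - ρb`, if the excess energy `x` or the excess data `y` is small. -/
theorem le_mul_add_of_supergradient_le {x y e ρa ρb ρT δ : ℝ} (hρT : 0 < ρT) (hTa : ρT ≤ ρa)
    (hb : 0 ≤ ρb) (hba : ρb ≤ ρa) (he : 0 ≤ e) (hδ : 0 ≤ δ) (hinv : y ≤ ρa * x + e)
    (hsmall : x ≤ δ ∨ y ≤ δ) :
    y ≤ ρb * x + e + δ * (1 + 1 / ρT) * (ρa - ρb) := by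
  have hd : 0 ≤ ρa - ρb := sub_nonneg.2 hba
  have hinvT : 0 ≤ 1 / ρT := by positivity
  have hK : δ * (ρa - ρb) ≤ δ * (1 + 1 / ρT) * (ρa - ρb) := by
    have : 0 ≤ δ * (1 / ρT) * (ρa - ρb) := by positivity
    linarith
  rcases hsmall with hx | hy
  · have : (ρa - ρb) * x ≤ (ρa - ρb) * δ := mul_le_mul_of_nonneg_left hx hd
    linarith
  · have hρa : 0 < ρa := hρT.trans_le hTa
    refine le_of_mul_le_mul_left (a := ρa) ?_ hρa
    have h1 : ρb * y ≤ ρb * (ρa * x + e) := mul_le_mul_of_nonneg_left hinv hb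
    have h2 : (ρa - ρb) * y ≤ (ρa - ρb) * δ := mul_le_mul_of_nonneg_left hy hd
    have h3 : ρb * e ≤ ρa * e := mul_le_mul_of_nonneg_right hba he
    have h4 : 1 ≤ ρa * (1 / ρT) := by
      rw [mul_one_div, le_div_iff₀ hρT]
      linarith
    have h5 : δ * (ρa - ρb) * 1 ≤ δ * (ρa - ρb) * (ρa * (1 / ρT)) :=
      mul_le_mul_of_nonneg_left h4 (by positivity)
    have h6 : 0 ≤ ρa * (δ * (ρa - ρb)) := by positivity
    nlinarith

/-- Complementary slackness is sufficient for optimality. Let `p` be nondecreasing and constant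
wherever the competitor `q` is ahead of it both in energy and in data. Then `q` cannot be
better at time `T`.

If `ρ t` denotes a supergradient of the rate function at the power `p t`, then the excess energy
`x` and the excess data `y` of `q` satisfy `y ≤ ρ * x` at all times: on constant pieces of `p` this
is the supergradient inequality, and `ρ` decreases only when `x ≤ 0` or `y ≤ 0`. The invariant
is proved along a uniform partition, with an error that is of the order of its mesh. -/
theorem energy_le_of_slackness (hr : IsRateFunction r) (hT : 0 < T) (hp : IsPowerCurve T p)
    (hq : IsPowerCurve T q) (hP : Monotone P) (hP0 : ∀ t, 0 ≤ P t)
    (hpP : ∀ᵐ τ ∂MeasureTheory.volume, τ ∈ Icc 0 T → p τ = P τ)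
    (hconst : ∀ a b, 0 ≤ a → a < b → b ≤ T → (∀ t ∈ Icc a b,
      energyCurve p t < energyCurve q t ∧ dataCurve r p t < dataCurve r q t) → P a = P b) :
    (dataCurve r p T ≤ dataCurve r q T → energyCurve p T ≤ energyCurve q T) ∧
      (dataCurve r p T < dataCurve r q T → energyCurve p T < energyCurve q T) := by
  have hTT : T ∈ Icc 0 T := ⟨hT.le, le_rfl⟩
  have h00 : (0 : ℝ) ∈ Icc 0 T := ⟨le_rfl, hT.le⟩
  rcases eq_or_lt_of_le (hP0 T) with hPT | hPT
  · -- the curve `p` vanishes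
    have hp0 : ∀ᵐ τ ∂MeasureTheory.volume, τ ∈ uIoc 0 T → p τ = 0 := hpP.mono fun τ h hτ => by
      rw [uIoc_of_le hT.le] at hτ
      rw [h ⟨hτ.1.le, hτ.2⟩]
      exact le_antisymm ((hP hτ.2).trans hPT.ge) (hP0 τ)
    have hE0 : energyCurve p T = 0 := by
      have := intervalIntegral.integral_congr_ae (g := fun _ => (0 : ℝ)) hp0
      simpa [energyCurve] using this
    refine ⟨fun _ => hE0.le.trans (hq.energyCurve_nonneg hTT), fun hlt => ?_⟩
    rw [hE0]
    refine lt_of_le_of_ne (hq.energyCurve_nonneg hTT) fun h0 => ?_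
    have h1 := hq.ae_eq_zero le_rfl hT.le le_rfl (by rw [← h0, energyCurve_zero])
    have h2 : dataCurve r q T = ∫ τ in (0 : ℝ)..T, r 0 :=
      IsRateFunction.integral_rate_congr_ae (q := fun _ => 0) (by rwa [uIoc_of_le hT.le])
    simp only [hr.zero, intervalIntegral.integral_zero] at h2
    exact absurd (hr.dataCurve_nonneg hp hTT) (by linarith)
  obtain ⟨R, hR, hRanti⟩ := hr.exists_supergradient
  -- it suffices to prove the invariant at time `T`
  suffices hmain : dataCurve r q T - dataCurve r p T ≤
      R (P T) * (energyCurve q T - energyCurve p T) by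
    have hpos := (hR _ hPT).1
    refine ⟨fun h => ?_, fun h => ?_⟩
    · exact sub_nonneg.1 (nonneg_of_mul_nonneg_right (by linarith) hpos)
    · exact sub_pos.1 (pos_of_mul_pos_right (by linarith) hpos.le)
  -- `x` is the excess energy and `y` the excess data
  let x : ℝ → ℝ := fun t => energyCurve q t - energyCurve p t
  let y : ℝ → ℝ := fun t => dataCurve r q t - dataCurve r p t
  obtain ⟨K, hK0, hxK, hyK⟩ : ∃ K, 0 ≤ K ∧
      (∀ a ∈ Icc 0 T, ∀ b ∈ Icc 0 T, a ≤ b → x a ≤ x b + K * (b - a)) ∧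
      (∀ a ∈ Icc 0 T, ∀ b ∈ Icc 0 T, a ≤ b → y a ≤ y b + K * (b - a)) := by
    obtain ⟨K, hK0, hK⟩ := hp.energyCurve_lipschitz
    obtain ⟨L, hL0, hL⟩ := (hr.rate hp).energyCurve_lipschitz
    refine ⟨K + L, by positivity, fun a ha b hb hab => ?_, fun a ha b hb hab => ?_⟩
    · have h1 := hK a ha b hb hab
      have h2 := hq.energyCurve_mono ha.1 hab hb.2
      have h3 := mul_nonneg hL0 (sub_nonneg.2 hab)
      simp only [x]
      linarith
    · have h1 : dataCurve r p b - dataCurve r p a ≤ L * (b - a) := hL a ha b hb hab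
      have h2 := hr.dataCurve_mono hq ha.1 hab hb.2
      have h3 := mul_nonneg hK0 (sub_nonneg.2 hab)
      simp only [y]
      linarith
  -- the invariant up to an error, for a mesh `T / N` and a positive lower cut-off `c₀` of the power;
  -- the cut-off is needed because the rate function may have infinite slope at `0`
  have key : ∀ c₀, 0 < c₀ → c₀ ≤ P T → ∀ N : ℕ, 0 < N → y T ≤ R (P T) * x T + T * r c₀ +
      T / N * (r (P T) + K * (1 + 1 / R (P T)) * R c₀) := by
    intro c₀ hc₀ hc₀T N hN
    have hN' : (0 : ℝ) < N := Nat.cast_pos.2 hN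
    set h := T / N with hh
    have hhpos : 0 < h := div_pos hT hN'
    have hhN : N * h = T := by rw [hh]; field_simp
    let c : ℝ → ℝ := fun t => max (P t) c₀
    have hcpos : ∀ t, 0 < c t := fun t => hc₀.trans_le (le_max_right _ _)
    have hcmono : ∀ s t, s ≤ t → c s ≤ c t := fun s t hst => max_le_max_right _ (hP hst)
    have hcT : c T = P T := max_eq_left hc₀T
    have hRpos : ∀ t, 0 < R (c t) := fun t => (hR _ (hcpos t)).1
    have hRmono : ∀ s t, s ≤ t → R (c t) ≤ R (c s) := fun s t hst =>
      hRanti (hcpos s) (hcpos t) (hcmono s t hst)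
    let C := K * (1 + 1 / R (P T))
    have hC : 0 ≤ C := mul_nonneg hK0 (by have := (hR _ hPT).1; positivity)
    have hrc₀ := hr.nonneg hc₀.le
    have hind : ∀ i : ℕ, i ≤ N → y (i * h) ≤ R (c (i * h)) * x (i * h) +
        (h * r (c (i * h)) + i * h * r c₀ + h * C * (R c₀ - R (c (i * h)))) := by
      intro i
      induction i with
      | zero =>
        intro _
        have h1 : R (c 0) ≤ R c₀ := hRanti hc₀ (hcpos 0) (le_max_right _ _)
        have h2 : 0 ≤ h * C * (R c₀ - R (c 0)) :=
          mul_nonneg (mul_nonneg hhpos.le hC) (sub_nonneg.2 h1)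
        have h3 := mul_nonneg hhpos.le (hr.nonneg (hcpos 0).le)
        have hx0 : x 0 = 0 := by simp [x, energyCurve_zero]
        have hy0 : y 0 = 0 := by simp [y, dataCurve_zero]
        rw [Nat.cast_zero, zero_mul, hx0, hy0]
        linarith
      | succ i ih =>
        intro hi
        have ih := ih (by omega)
        have hiN : ((i + 1 : ℕ) : ℝ) * h ≤ T := by
          rw [← hhN]
          exact mul_le_mul_of_nonneg_right (Nat.cast_le.2 hi) hhpos.le
        have hb : ((i + 1 : ℕ) : ℝ) * h = i * h + h := by push_cast; ring
        have hir : ((i + 1 : ℕ) : ℝ) * h * r c₀ = i * h * r c₀ + h * r c₀ := by rw [hb]; ring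
        rw [hir]
        rw [hb] at hiN ⊢
        have ha0 : 0 ≤ i * h := by positivity
        have hpos_e : 0 ≤ i * h * r c₀ := by positivity
        generalize hA : (i : ℝ) * h = a at *
        have haT : a ∈ Icc 0 T := ⟨ha0, by linarith⟩
        have hbT : a + h ∈ Icc 0 T := ⟨by linarith, hiN⟩
        have hab : a ≤ a + h := by linarith
        have hstep := hr.data_step_le hp hq hP hP0 hpP ha0 hab hiN
          (le_max_left (P (a + h)) c₀) (hRpos (a + h)).le (hR _ (hcpos (a + h))).2
        have hcut : r (c a) - r c₀ ≤ r (P a) := by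
          rcases le_total (P a) c₀ with h1 | h1
          · have := hr.nonneg (hP0 a)
            simp only [c, max_eq_right h1]
            linarith
          · simp only [c, max_eq_left h1]
            linarith
        have hRa : R (c a) ≤ R c₀ := hRanti hc₀ (hcpos a) (le_max_right _ _)
        have he : 0 ≤ h * r (c a) + i * h * r c₀ + h * C * (R c₀ - R (c a)) := by
          have h1 := mul_nonneg hhpos.le (hr.nonneg (hcpos a).le)
          have h2 : 0 ≤ h * C * (R c₀ - R (c a)) :=
            mul_nonneg (mul_nonneg hhpos.le hC) (sub_nonneg.2 hRa)
          have h3 : 0 ≤ i * h * r c₀ := by positivity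
          linarith
        rw [hA] at he
        have hmid : y a ≤ R (c (a + h)) * x a +
            (h * r (c a) + a * r c₀ + h * C * (R c₀ - R (c a))) +
            K * h * (1 + 1 / R (P T)) * (R (c a) - R (c (a + h))) := by
          have hloss : 0 ≤ K * h * (1 + 1 / R (P T)) * (R (c a) - R (c (a + h))) := by
            have h1 := (hR _ hPT).1
            have h2 := sub_nonneg.2 (hRmono _ _ hab)
            positivity
          by_cases hall : ∀ t ∈ Icc a (a + h),
              energyCurve p t < energyCurve q t ∧ dataCurve r p t < dataCurve r q t
          · have h1 := hconst a (a + h) ha0 (by linarith) hiN hall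
            have h2 : c a = c (a + h) := by simp only [c, h1]
            rw [← h2] at hloss ⊢
            linarith
          · have hRT : R (P T) ≤ R (c a) := hcT ▸ hRmono a T haT.2
            refine le_mul_add_of_supergradient_le (hR _ hPT).1 hRT (hRpos _).le
              (hRmono _ _ hab) he (by positivity) ih ?_
            push Not at hall
            obtain ⟨t, ht, hor⟩ := hall
            have htT : t ∈ Icc 0 T := ⟨ha0.trans ht.1, ht.2.trans hiN⟩
            have hKt : K * (t - a) ≤ K * h := mul_le_mul_of_nonneg_left (by linarith [ht.2]) hK0
            by_cases hEt : energyCurve p t < energyCurve q t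
            · right
              have h1 := hyK a haT t htT ht.1
              have h2 : y t ≤ 0 := sub_nonpos.2 (hor hEt)
              linarith
            · left
              have h1 := hxK a haT t htT ht.1
              have h2 : x t ≤ 0 := sub_nonpos.2 (not_lt.1 hEt)
              linarith
        have hstep' : y (a + h) - y a ≤ R (c (a + h)) * (x (a + h) - x a) +
            h * (r (c (a + h)) - r (P a)) := by
          have : a + h - a = h := by ring
          rw [this] at hstep
          exact hstep
        have hcut' := mul_le_mul_of_nonneg_left hcut hhpos.le
        simp only [C]
        simp only [C] at hmid
        linarith
    have hfinal := hind N le_rfl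
    rw [hhN, hcT] at hfinal
    have h1 : 0 ≤ h * C * R (P T) := mul_nonneg (mul_nonneg hhpos.le hC) (hR _ hPT).1.le
    simp only [C] at hfinal h1
    linarith
  -- let first the mesh and then the cut-off tend to zero
  have key' : ∀ c₀, 0 < c₀ → c₀ ≤ P T → y T ≤ R (P T) * x T + T * r c₀ := by
    intro c₀ hc₀ hc₀T
    refine ge_of_tendsto (x := atTop) (f := fun N : ℕ => R (P T) * x T + T * r c₀ +
      T / N * (r (P T) + K * (1 + 1 / R (P T)) * R c₀)) ?_
      ((eventually_gt_atTop 0).mono fun N hN => key c₀ hc₀ hc₀T N hN)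
    have := ((tendsto_const_div_atTop_nhds_zero_nat T).mul_const
      (r (P T) + K * (1 + 1 / R (P T)) * R c₀)).const_add (R (P T) * x T + T * r c₀)
    simpa using this
  have hlim : Tendsto (fun c₀ => R (P T) * x T + T * r c₀) (𝓝[>] 0) (𝓝 (R (P T) * x T)) := by
    have h1 : Tendsto r (𝓝[>] 0) (𝓝 0) := by
      have := (hr.continuousOn 0 (mem_Ici.2 le_rfl)).tendsto
      rw [hr.zero] at this
      exact this.mono_left (nhdsWithin_mono _ Ioi_subset_Ici_self)
    simpa using (h1.const_mul T).const_add (R (P T) * x T)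
  refine ge_of_tendsto hlim ?_
  filter_upwards [Ioc_mem_nhdsGT hPT] with c₀ hc₀ using key' c₀ hc₀.1 hc₀.2

end Sufficiency

/-! ### Delivering less data by capping the power -/

theorem IsRateFunction.exists_cap {r p : ℝ → ℝ} {T V : ℝ} (hr : IsRateFunction r) (hT : 0 ≤ T)
    (hp : IsPowerCurve T p)
    (hV0 : 0 ≤ V) (hV : V ≤ dataCurve r p T) :
    ∃ c, 0 ≤ c ∧ dataCurve r (fun τ => min (p τ) c) T = V := by
  obtain ⟨e, he⟩ := hr.exists_orderIso
  obtain ⟨M, hM⟩ := hp.1.exists_bound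
  have hM' : ∀ t ∈ Icc 0 T, p t ≤ M := fun t ht => (le_abs_self _).trans (hM t ht)
  have h0 : (0 : ℝ) ∈ Icc 0 T := ⟨le_rfl, hT⟩
  have hM0 : 0 ≤ M := (hp.2 0 h0).trans (hM' 0 h0)
  let F : ℝ → ℝ := fun c => ∫ τ in (0 : ℝ)..T, e (min (p τ) (max c 0))
  have hF : ∀ c, 0 ≤ c → F c = dataCurve r (fun τ => min (p τ) c) T := fun c hc => by
    refine intervalIntegral.integral_congr fun τ hτ => ?_
    rw [uIcc_of_le hT] at hτ
    simp only [max_eq_left hc]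
    exact he _ (le_min (hp.2 τ hτ) hc)
  have hcont : Continuous F := by
    refine intervalIntegral.continuous_of_dominated_interval (bound := fun _ => r M)
      (fun c => ?_) (fun c => .of_forall fun τ hτ => ?_) intervalIntegrable_const
      (.of_forall fun τ _ => by fun_prop)
    · rw [uIoc_of_le hT]
      exact ((hp.1.comp (φ := fun x => e (min x (max c 0))) (by fun_prop)).integrableOn.mono_set
        Ioc_subset_Icc_self).aestronglyMeasurable
    · rw [uIoc_of_le hT] at hτ
      have hτ' : τ ∈ Icc 0 T := ⟨hτ.1.le, hτ.2⟩
      have hm : 0 ≤ min (p τ) (max c 0) := le_min (hp.2 τ hτ') (le_max_right _ _)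
      rw [he _ hm, Real.norm_of_nonneg (hr.nonneg hm)]
      exact hr.mono hm ((min_le_left _ _).trans (hM' τ hτ'))
  have hF0 : F 0 = 0 := by
    rw [hF 0 le_rfl]
    have : dataCurve r (fun τ => min (p τ) 0) T = ∫ τ in (0 : ℝ)..T, r 0 := by
      refine intervalIntegral.integral_congr fun τ hτ => ?_
      rw [uIcc_of_le hT] at hτ
      simp only [min_eq_right (hp.2 τ hτ)]
    simpa [hr.zero] using this
  have hFM : F M = dataCurve r p T := by
    rw [hF M hM0]
    refine intervalIntegral.integral_congr fun τ hτ => ?_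
    rw [uIcc_of_le hT] at hτ
    simp only [min_eq_left (hM' τ hτ)]
  obtain ⟨c, hc, hcV⟩ := intermediate_value_Icc hM0 hcont.continuousOn
    (show V ∈ Icc (F 0) (F M) from ⟨by rwa [hF0], by rwa [hFM]⟩)
  exact ⟨c, hc.1, by rw [← hF c hc.1, hcV]⟩

namespace PtPOptimal

variable {r E B p : ℝ → ℝ} {T : ℝ}

/-- Capping an optimal power curve at a level `c` gives the most energy-efficient way to deliver
a smaller amount `V` of data. The capped data curve still dominates each convex curve that is
dominated by the original one and ends at or below `V`. -/
theorem exists_capped (hr : IsRateFunction r) (hT : 0 < T) (hE : MonotoneOn E (Icc 0 T))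
    (hB : MonotoneOn B (Icc 0 T)) (h : PtPOptimal r E B T p) {V : ℝ} (hV0 : 0 ≤ V)
    (hV : V ≤ dataCurve r p T) :
    ∃ s, PtPFeasible r E B T s ∧ dataCurve r s T = V ∧
      (∀ q, PtPFeasible r E B T q → V ≤ dataCurve r q T → energyCurve s T ≤ energyCurve q T) ∧
      ∀ C : ℝ → ℝ, ConvexOn ℝ (Icc 0 T) C → ContinuousOn C (Icc 0 T) → C 0 ≤ 0 → C T ≤ V →
        (∀ t ∈ Icc 0 T, C t ≤ dataCurve r p t) → ∀ t ∈ Icc 0 T, C t ≤ dataCurve r s t := by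
  have hp := h.isPowerCurve
  obtain ⟨c, hc, hcV⟩ := hr.exists_cap hT.le hp hV0 hV
  obtain ⟨P, hP, hP0, hpP, hPconst⟩ := hp.exists_monotone hr (h.convexOn_dataCurve hr hT.le)
  let s : ℝ → ℝ := fun τ => min (p τ) c
  have hs : IsPowerCurve T s := ⟨hp.1.comp (φ := fun x => min x c) (by fun_prop),
    fun t ht => le_min (hp.2 t ht) hc⟩
  have h0 : (0 : ℝ) ∈ Icc 0 T := ⟨le_rfl, hT.le⟩
  have hsE : ∀ t ∈ Icc 0 T, energyCurve s t ≤ energyCurve p t := fun t ht =>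
    intervalIntegral.integral_mono_on ht.1 (hs.1.intervalIntegrable h0 ht)
      (hp.1.intervalIntegrable h0 ht) fun x _ => min_le_left _ _
  have hsD : ∀ t ∈ Icc 0 T, dataCurve r s t ≤ dataCurve r p t := fun t ht =>
    intervalIntegral.integral_mono_on ht.1 ((hr.rate hs).1.intervalIntegrable h0 ht)
      ((hr.rate hp).1.intervalIntegrable h0 ht) fun x hx =>
        hr.mono (hs.2 x ⟨hx.1, hx.2.trans ht.2⟩) (min_le_left _ _)
  have hfeas : PtPFeasible r E B T s := ⟨hs.1, hs.2,
    fun t ht => (hsE t ht).trans (h.feasible.energy_causal t ht),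
    fun t ht => (hsD t ht).trans (h.feasible.data_causal t ht)⟩
  -- before the power reaches the cap the curves agree
  have heq : ∀ t ∈ Icc 0 T, P t ≤ c →
      energyCurve s t = energyCurve p t ∧ dataCurve r s t = dataCurve r p t := by
    intro t ht htc
    have hae : ∀ᵐ τ ∂MeasureTheory.volume, τ ∈ uIoc 0 t → s τ = p τ := by
      filter_upwards [hpP] with τ hτ hτt
      rw [uIoc_of_le ht.1] at hτt
      have := hτ ⟨hτt.1.le, hτt.2.trans ht.2⟩
      exact min_eq_left (this.le.trans ((hP hτt.2).trans htc))
    exact ⟨intervalIntegral.integral_congr_ae hae, IsRateFunction.integral_rate_congr_ae hae⟩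
  refine ⟨s, hfeas, hcV, fun q hq hqV => ?_, fun C hC hCc hC0 hCT hCle t ht => ?_⟩
  · refine (energy_le_of_slackness hr hT hs hq.isPowerCurve (P := fun t => min (P t) c)
      (hP.min monotone_const) (fun t => le_min (hP0 t) hc)
      (hpP.mono fun τ hτ hτT => by simp only [s, hτ hτT]) ?_).1 (hcV.le.trans hqV)
    intro a b ha hab hb hlt
    by_contra hne
    have hac : P a < c := by
      by_contra hn
      have h1 := not_lt.1 hn
      exact hne (by rw [min_eq_right h1, min_eq_right (h1.trans (hP hab.le))])
    have haT : a ∈ Icc 0 T := ⟨ha, hab.le.trans hb⟩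
    have hDa := (hlt a ⟨le_rfl, hab.le⟩).2
    rw [(heq a haT hac.le).2] at hDa
    obtain ⟨α, β, hα, hαa, haβ, hβ, -, hβeq, haff⟩ := h.exists_affine_component hr hE hB hq haT hDa
    have hPβ := hPconst α β hα (hαa.trans haβ) hβ haff
    rcases le_or_gt b β with hbβ | hbβ
    · exact hne (by rw [hPβ a ⟨hαa, haβ.le⟩ b ⟨hαa.trans hab, hbβ⟩])
    · -- the cap is not reached at `β`, where the optimal curve has caught up with `q`
      have h1 : P β ≤ c := by
        rw [← hPβ a ⟨hαa, haβ.le⟩ β ⟨hαa.trans haβ, le_rfl⟩]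
        exact hac.le
      have h2 := (hlt β ⟨haβ.le, hbβ.le⟩).2
      rw [(heq β ⟨ha.trans haβ.le, hβ⟩ h1).2, hβeq] at h2
      exact lt_irrefl _ h2
  · by_contra hlt
    rw [not_le] at hlt
    obtain ⟨α, β, hα, hαt, htβ, hβ, hα0, hβ0, hpos⟩ := exists_positive_component
      (f := fun u => C u - dataCurve r s u) (hCc.sub (hr.continuousOn_dataCurve hs)) ht
      (by simpa [dataCurve_zero] using hC0) (by rw [hcV]; linarith) (sub_pos.2 hlt)
    have hPc : ∀ u ∈ Ioo α β, c < P u := fun u hu => by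
      by_contra hn
      have huT : u ∈ Icc 0 T := ⟨hα.trans hu.1.le, hu.2.le.trans hβ⟩
      have h1 := (heq u huT (not_lt.1 hn)).2
      have h2 := hpos u hu
      have h3 := hCle u huT
      linarith
    -- above the cap the power is constant
    have hlin : ∀ u ∈ Icc α β, dataCurve r s u = dataCurve r s α + r c * (u - α) := fun u hu => by
      have h1 : dataCurve r s u - dataCurve r s α = ∫ τ in α..u, r (s τ) :=
        (hr.rate hs).energyCurve_sub ⟨hα, (hαt.trans htβ).le.trans hβ⟩
          ⟨hα.trans hu.1, hu.2.trans hβ⟩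
      have hβn : ∀ᵐ τ ∂MeasureTheory.volume, τ ≠ β := by
        have : MeasureTheory.volume ({β} : Set ℝ) = 0 := by simp
        simpa using MeasureTheory.measure_eq_zero_iff_ae_notMem.1 this
      have hae : ∀ᵐ τ ∂MeasureTheory.volume, τ ∈ uIoc α u → s τ = c := by
        filter_upwards [hpP, hβn] with τ hτ hτβ hτu
        rw [uIoc_of_le hu.1] at hτu
        have hτβ' : τ < β := lt_of_le_of_ne (hτu.2.trans hu.2) hτβ
        have h2 := hτ ⟨hα.trans hτu.1.le, hτβ'.le.trans hβ⟩
        exact min_eq_right (h2 ▸ (hPc τ ⟨hτu.1, hτβ'⟩).le)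
      rw [IsRateFunction.integral_rate_congr_ae (q := fun _ => c) hae,
        intervalIntegral.integral_const, smul_eq_mul] at h1
      linarith
    have haff : IsAffineOn (dataCurve r s) α β := fun u hu => by
      rw [hlin u hu, hlin β ⟨(hαt.trans htβ).le, le_rfl⟩]
      ring
    have := haff.le_of_convexOn hC hα hαt htβ hβ (by linarith) (by linarith)
    linarith

end PtPOptimal

/-! ### The relay -/

section Relay

variable {rsr rrd Es Er Bs psr prd p q : ℝ → ℝ} {T : ℝ}

/-- Whatever the source does, the relay cannot deliver more data than with the optimal curve `prd`
for the optimal source curve `psr`, nor as much data with less energy. A relay curve `q` is ahead of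
`prd` at a time when `prd` has forwarded all the data of `psr` only if the source is ahead of `psr`
there; but then `psr` has constant rate around this time, and so has `prd`. Therefore the
slackness conditions hold for `prd` and `q`, although `q` need not be feasible for the data
of `psr`. -/
theorem relay_comparison (hT : 0 < T) (hrsr : IsRateFunction rsr) (hrrd : IsRateFunction rrd)
    (hEs : MonotoneOn Es (Icc 0 T)) (hBs : MonotoneOn Bs (Icc 0 T))
    (hpsr : PtPOptimal rsr Es Bs T psr) (hprd : PtPOptimal rrd Er (dataCurve rsr psr) T prd)
    (hpq : TwoHopFeasible rsr rrd Es Er Bs T p q) :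
    dataCurve rrd q T ≤ dataCurve rrd prd T ∧
      (dataCurve rrd prd T ≤ dataCurve rrd q T → energyCurve prd T ≤ energyCurve q T) := by
  have hw := hprd.isPowerCurve
  have hq := hpq.relay.isPowerCurve
  have hcw := hrrd.continuousOn_dataCurve hw
  have hcq := hrrd.continuousOn_dataCurve hq
  have hcs := hrsr.continuousOn_dataCurve hpsr.isPowerCurve
  have hconv := hprd.convexOn_dataCurve hrrd hT.le
  obtain ⟨P, hP, hP0, hpP, hPconst⟩ := hw.exists_monotone hrrd hconv
  obtain ⟨hle, hlt⟩ := energy_le_of_slackness hrrd hT hw hq hP hP0 hpP (by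
    intro a₀ b ha₀ hab₀ hb hahead
    have ha₀T : a₀ ≤ T := hab₀.le.trans hb
    have hne : 0 < a₀ := lt_of_le_of_ne ha₀ fun h0 => by
      have := (hahead a₀ ⟨le_rfl, hab₀.le⟩).1
      rw [← h0, energyCurve_zero, energyCurve_zero] at this
      exact lt_irrefl _ this
    obtain ⟨s₁, hs₁, hs₁a, hE₁⟩ := exists_lt_on_left hw.continuousOn_energyCurve
      hq.continuousOn_energyCurve hne ha₀T (hahead a₀ ⟨le_rfl, hab₀.le⟩).1
    obtain ⟨s₂, hs₂, hs₂a, hD₂⟩ := exists_lt_on_left hcw hcq hne ha₀T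
      (hahead a₀ ⟨le_rfl, hab₀.le⟩).2
    -- `q` is ahead already from some time `a < a₀`
    obtain ⟨a, ha, haa₀, hahead'⟩ : ∃ a, 0 < a ∧ a < a₀ ∧ ∀ t ∈ Icc a b,
        energyCurve prd t < energyCurve q t ∧ dataCurve rrd prd t < dataCurve rrd q t := by
      refine ⟨max s₁ s₂, lt_max_of_lt_left hs₁, max_lt hs₁a hs₂a, fun t ht => ?_⟩
      rcases le_total t a₀ with h | h
      · exact ⟨hE₁ t ⟨(le_max_left _ _).trans ht.1, h⟩, hD₂ t ⟨(le_max_right _ _).trans ht.1, h⟩⟩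
      · exact hahead t ⟨h, ht.2⟩
    have hab : a < b := haa₀.trans hab₀
    have hsub : Icc a b ⊆ Icc 0 T := Icc_subset_Icc ha.le hb
    by_cases htight : ∃ τ ∈ Icc a b, dataCurve rsr psr τ ≤ dataCurve rrd prd τ
    · obtain ⟨τ, hτ, hτle⟩ := htight
      have hτT := hsub hτ
      have hsrc : dataCurve rsr psr τ < dataCurve rsr p τ :=
        (hτle.trans_lt (hahead' τ hτ).2).trans_le (hpq.relay.data_causal τ hτT)
      obtain ⟨α, β, hα, hατ, hτβ, hβ, hαeq, hβeq, haff⟩ :=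
        hpsr.exists_affine_component hrsr hEs hBs hpq.source hτT hsrc
      have hsubαβ : Icc α β ⊆ Icc 0 T := Icc_subset_Icc hα hβ
      have hαβ := (hατ.trans hτβ).le
      have hcoin := haff.of_convexOn_touch hconv hα hατ hτβ hβ
        (fun x hx => hprd.feasible.data_causal x (hsubαβ hx))
        (le_antisymm (hprd.feasible.data_causal τ hτT) hτle)
      -- where the source curves meet, `q` is not ahead
      have hout : ∀ x ∈ Icc α β, dataCurve rsr p x = dataCurve rsr psr x → x ∉ Icc a b :=
        fun x hx hxeq hxab => by
          have h1 := (hahead' x hxab).2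
          have h2 := hpq.relay.data_causal x (hsub hxab)
          rw [hxeq, ← hcoin x hx] at h2
          linarith
      have hαa : α < a := by
        by_contra hn
        exact hout α ⟨le_rfl, hαβ⟩ hαeq ⟨not_lt.1 hn, hατ.le.trans hτ.2⟩
      have hbβ : b < β := by
        by_contra hn
        exact hout β ⟨hαβ, le_rfl⟩ hβeq ⟨hτ.1.trans hτβ.le, not_lt.1 hn⟩
      have haff' : IsAffineOn (dataCurve rrd prd) α β := fun x hx => by
        rw [hcoin x hx, hcoin α ⟨le_rfl, hαβ⟩, hcoin β ⟨hαβ, le_rfl⟩]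
        exact haff x hx
      exact hPconst α β hα (hατ.trans hτβ) hβ haff' a₀ ⟨hαa.trans haa₀, hab₀.le.trans hbβ.le⟩
        b ⟨hαa.trans hab, hbβ.le⟩
    · push Not at htight
      obtain ⟨ε, hε, hDε⟩ := exists_pos_le_of_continuousOn (hcw.mono hsub) (hcs.mono hsub) htight
      obtain ⟨δ, hδ, hEδ⟩ := exists_pos_le_of_continuousOn (hw.continuousOn_energyCurve.mono hsub)
        (hq.continuousOn_energyCurve.mono hsub) fun t ht => (hahead' t ht).1
      have haff := hprd.isAffineOn hrrd hT.le ha.le hab hb (lt_min hε hδ) fun t ht => by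
        have ht' : t ∈ Icc a b := ⟨ht.1.le, ht.2.le⟩
        have h1 := hDε t ht'
        have h2 := hEδ t ht'
        have h3 := hpq.relay.energy_causal t (hsub ht')
        have h5 := min_le_left ε δ
        have h6 := min_le_right ε δ
        right
        constructor <;> linarith
      exact hPconst a b ha.le hab hb haff a₀ ⟨haa₀, hab₀.le⟩ b ⟨hab, le_rfl⟩)
  refine ⟨?_, hle⟩
  -- more data would take more energy, so `prd` would have slack at time `T`
  by_contra hmore
  rw [not_le] at hmore
  have hTT : T ∈ Icc 0 T := ⟨hT.le, le_rfl⟩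
  have hdata : dataCurve rrd prd T < dataCurve rsr psr T :=
    (hmore.trans_le (hpq.relay.data_causal T hTT)).trans_le (hpsr.throughput_max p hpq.source)
  obtain ⟨s₁, hs₁, hs₁T, hE₁⟩ := exists_lt_on_left hw.continuousOn_energyCurve
    hq.continuousOn_energyCurve hT le_rfl (hlt hmore)
  obtain ⟨s₂, hs₂, hs₂T, hD₂⟩ := exists_lt_on_left hcw hcs hT le_rfl hdata
  set a := max s₁ s₂
  have ha : 0 < a := lt_max_of_lt_left hs₁
  have haT : a < T := max_lt hs₁T hs₂T
  have hsub : Icc a T ⊆ Icc 0 T := Icc_subset_Icc ha.le le_rfl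
  obtain ⟨ε, hε, hDε⟩ := exists_pos_le_of_continuousOn (hcw.mono hsub) (hcs.mono hsub)
    fun t ht => hD₂ t ⟨(le_max_right _ _).trans ht.1, ht.2⟩
  obtain ⟨δ, hδ, hEδ⟩ := exists_pos_le_of_continuousOn (hw.continuousOn_energyCurve.mono hsub)
    (hq.continuousOn_energyCurve.mono hsub) fun t ht => hE₁ t ⟨(le_max_left _ _).trans ht.1, ht.2⟩
  have hTa : 0 < T - a := sub_pos.2 haT
  obtain ⟨x, hx0, hx⟩ := ((eventually_ge_atTop 0).and (hrrd.tendsto_atTop.eventually_gt_atTop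
    ((dataCurve rrd prd T - dataCurve rrd prd a) / (T - a)))).exists
  rw [div_lt_iff₀ hTa] at hx
  obtain ⟨v, hv, hlow, hmid, -⟩ := hrrd.exists_hold hw ha.le haT.le le_rfl hx0
  have hmax := (hprd.perturb hrrd hT.le hv (lt_min hε hδ)
    (fun t ht => by
      rcases le_or_gt t a with h | h
      · exact Or.inl (hlow t ht.1 h).1.le
      · have h1 := hEδ t ⟨h.le, ht.2⟩
        have h2 := hpq.relay.energy_causal t ht
        have h3 := min_le_right ε δ
        exact Or.inr (by linarith))
    (fun t ht => by
      rcases le_or_gt t a with h | h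
      · exact Or.inl (hlow t ht.1 h).2.le
      · have h1 := hDε t ⟨h.le, ht.2⟩
        have h3 := min_le_left ε δ
        exact Or.inr (by linarith))).1
  rw [(hmid T haT.le le_rfl).2] at hmax
  linarith

/-- The strict form of `relay_comparison`: averaging two policies in the rate domain gives a
feasible policy that uses less energy. -/
theorem relay_energy_lt (hT : 0 < T) (hrsr : IsRateFunction rsr) (hrrd : IsRateFunction rrd)
    (hEs : MonotoneOn Es (Icc 0 T)) (hBs : MonotoneOn Bs (Icc 0 T))
    (hpsr : PtPOptimal rsr Es Bs T psr) (hprd : PtPOptimal rrd Er (dataCurve rsr psr) T prd)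
    (hpq : TwoHopFeasible rsr rrd Es Er Bs T p q)
    (heq : dataCurve rrd q T = dataCurve rrd prd T)
    (hne : ¬ EqOn (dataCurve rrd q) (dataCurve rrd prd) (Icc 0 T)) :
    energyCurve prd T < energyCurve q T := by
  have hTT : T ∈ Icc 0 T := ⟨hT.le, le_rfl⟩
  obtain ⟨s, hs, hsD, hsE, -⟩ := hrsr.exists_mix hT.le hpq.source.isPowerCurve hpsr.isPowerCurve
    (l := 1 / 2) (by norm_num) (by norm_num)
  obtain ⟨v, hv, hvD, hvE, hvlt⟩ := hrrd.exists_mix hT.le hpq.relay.isPowerCurve hprd.isPowerCurve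
    (l := 1 / 2) (by norm_num) (by norm_num)
  have hfeas : TwoHopFeasible rsr rrd Es Er Bs T s v := by
    refine ⟨⟨hs.1, hs.2, fun t ht => ?_, fun t ht => ?_⟩, ⟨hv.1, hv.2, fun t ht => ?_,
      fun t ht => ?_⟩⟩
    · have h1 := hsE t ht
      have h2 := hpq.source.energy_causal t ht
      have h3 := hpsr.feasible.energy_causal t ht
      linarith
    · have h1 := hsD t ht
      have h2 := hpq.source.data_causal t ht
      have h3 := hpsr.feasible.data_causal t ht
      linarith
    · have h1 := hvE t ht
      have h2 := hpq.relay.energy_causal t ht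
      have h3 := hprd.feasible.energy_causal t ht
      linarith
    · have h1 := hvD t ht
      have h2 := hpq.relay.data_causal t ht
      have h3 := hprd.feasible.data_causal t ht
      have h4 := hsD t ht
      linarith
  have h1 := (relay_comparison hT hrsr hrrd hEs hBs hpsr hprd hfeas).2
    (by rw [hvD T hTT, heq]; linarith)
  have h2 := hvlt hne
  linarith

end Relay

/-! ### The two-hop problem -/

theorem theorem3p1 (T : ℝ) (hT : 0 < T) (rsr rrd Es Er Bs : ℝ → ℝ)
    (hrsr : IsRateFunction rsr) (hrrd : IsRateFunction rrd)
    (hEs : IsArrivalCurve T Es) (hEr : IsArrivalCurve T Er) (hBs : IsArrivalCurve T Bs)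
    (psr prd : ℝ → ℝ)
    (hpsr : PtPOptimal rsr Es Bs T psr)
    (hprd : PtPOptimal rrd Er (dataCurve rsr psr) T prd) :
    -- the relay curve obtained in the two steps is that of an optimal two-hop policy
    (∃ p, TwoHopOptimal rsr rrd Es Er Bs T p prd) ∧
    -- and it is the relay curve of every optimal two-hop policy
    (∀ p q, TwoHopOptimal rsr rrd Es Er Bs T p q →
      EqOn (dataCurve rrd q) (dataCurve rrd prd) (Icc 0 T)) ∧
    -- it dominates the optimal relay curve of every feasible source policy at all times
    (∀ p q, PtPFeasible rsr Es Bs T p → PtPOptimal rrd Er (dataCurve rsr p) T q →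
      ∀ t ∈ Icc 0 T, dataCurve rrd q t ≤ dataCurve rrd prd t) ∧
    -- and it uses less relay energy than any other relay curve that delivers as much data
    (∀ p q, TwoHopFeasible rsr rrd Es Er Bs T p q →
      dataCurve rrd q T = dataCurve rrd prd T →
      energyCurve prd T ≤ energyCurve q T ∧
      (¬ EqOn (dataCurve rrd q) (dataCurve rrd prd) (Icc 0 T) →
        energyCurve prd T < energyCurve q T)) := by
  have hTT : T ∈ Icc 0 T := ⟨hT.le, le_rfl⟩
  have hw := hprd.isPowerCurve
  have hcw := hrrd.continuousOn_dataCurve hw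
  have hcomp := fun p q (hpq : TwoHopFeasible rsr rrd Es Er Bs T p q) =>
    relay_comparison hT hrsr hrrd hEs.mono hBs.mono hpsr hprd hpq
  obtain ⟨s, hs, hsV, hsmin, hsdom⟩ := hpsr.exists_capped hrsr hT hEs.mono hBs.mono
    (hrrd.dataCurve_nonneg hw hTT) (hprd.feasible.data_causal T hTT)
  have hopt : TwoHopOptimal rsr rrd Es Er Bs T s prd := by
    refine ⟨⟨hs, ⟨hw.1, hw.2, hprd.feasible.energy_causal, ?_⟩⟩, fun p' q' h' => (hcomp p' q' h').1,
      fun p' q' h' heq => ⟨hsmin p' h'.source ?_, (hcomp p' q' h').2 heq.ge⟩⟩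
    · exact hsdom _ (hprd.convexOn_dataCurve hrrd hT.le) hcw (dataCurve_zero _ _).le le_rfl
        hprd.feasible.data_causal
    · rw [← heq]
      exact h'.relay.data_causal T hTT
  refine ⟨⟨s, hopt⟩, fun p q hpq => ?_, fun p q hp hq => ?_, fun p q hpq heq =>
    ⟨(hcomp p q hpq).2 heq.ge, relay_energy_lt hT hrsr hrrd hEs.mono hBs.mono hpsr hprd hpq heq⟩⟩
  · have heq := le_antisymm (hcomp p q hpq.feasible).1 (hpq.throughput_max s prd hopt.feasible)
    by_contra hne
    have h1 := relay_energy_lt hT hrsr hrrd hEs.mono hBs.mono hpsr hprd hpq.feasible heq hne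
    have h2 := (hpq.energy_min s prd hopt.feasible heq.symm).2
    linarith
  · -- the optimal relay data curve is convex, so `psr` also supports it, and `prd` dominates it
    have hconv := hq.convexOn_dataCurve hrrd hT.le
    have hcq := hrrd.continuousOn_dataCurve hq.isPowerCurve
    have h0 := (dataCurve_zero rrd q).le
    have hle := hpsr.le_dataCurve_of_convexOn hrsr hEs.mono hBs.mono hp hconv hcq h0
      hq.feasible.data_causal
    exact hprd.le_dataCurve_of_convexOn hrrd hEr.mono (hrsr.monotoneOn_dataCurve hpsr.isPowerCurve)
      ⟨hq.feasible.1, hq.feasible.2, hq.feasible.energy_causal, hle⟩ hconv hcq h0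
      fun _ _ => le_rfl
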